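/- **Setting.** Let $\mathcal Z$ be a measurable space of data points, $\mathcal W$ a standard Borel space of hypotheses, $D$ a probability measure on the space of probability measures on $\mathcal Z$, and $K,n\ge 1$. Clients $\mu_1,\dots,\mu_K$ are drawn i.i.d. from $D$ and, given the clients, data points $z_{i,1},\dots,z_{i,n}$ are drawn i.i.d. from $\mu_i$, independently over $i$ (a sampling tree with $L=2$ levels). An algorithm is a Markov kernel which, given the tree $t=(\mu_i,(z_{i,j})_j)_{i}$, outputs $W\in\mathcal W$. Let $\ell:\mathcal W\times\mathcal Z\to[0,1]$ be measurable, and $$\mathrm{gen}=\mathbb E\Big[\mathbb E_{\mu\sim D}\mathbb E_{z\sim\mu}\,\ell(W,z)-\frac1{nK}\sum_{i=1}^K\sum_{j=1}^n\ell(W,z_{i,j})\Big].$$ **Supersample.** For $i\in[K]$, $j\in[n]$ and $b,c\in\{0,1\}$ draw $\mu^{i,b}\sim D$ i.i.d., then $Z^{i,b}_{j,c}\sim\mu^{i,b}$ conditionally independently, and independent uniform bits $V_i$, $U^{i,b}_j$, independent of all the former. The algorithm is trained on the clients $\mu^{i,V_i}$ with data $Z^{i,V_i}_{j,U^{i,V_i}_j}$,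 which gives $W$. Write $\tilde\mu^i=(\mu^{i,0},\mu^{i,1})$, $\tilde Z^i=(Z^{i,b}_{j,c})_{b,j,c}$, $U^i=(U^{i,b}_j)_{b,j}$, $U_{i,j}=U^{i,V_i}_j$, and $\tilde Z_{i,j}=(Z^{i,V_i}_{j,0},Z^{i,V_i}_{j,1})$. Let $\mathbb W(P,Q)=\inf_\pi\pi(\{(x,y):x\ne y\})$, over the couplings $\pi$ of $P$ and $Q$, be the order one Wasserstein distance for the discrete metric, and for $x$ in the range of a random variable $X$ let $$I^{x}(W;Y)=D_{KL}\big(P_{W,Y|X=x}\,\|\,P_{W|X=x}\otimes P_{Y|X=x}\big).$$ The hierarchical Wasserstein bound (two levels, discrete metric, Lipschitz constant $1$) is $$B_{\mathbb W}=2\Big(\frac1K\sum_{i}\mathbb E_{\tilde\mu^i,V_i}\mathbb W\big(P_{W|\tilde\mu^i,V_i},P_{W|\tilde\mu^i}\big)+\frac1{nK}\sum_{i,j}\mathbb E_{\tilde Z_{i,j},U_{i,j}}\mathbb W\big(P_{W|\tilde Z_{i,j},U_{i,j}},P_{W|\tilde Z_{i,j}}\big)\Big).$$ The two-level CMI bound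 (the sum of a participation-gap term and an out-of-sample-gap term) is $$B_{\mathrm{CMI}}=\frac1K\sum_{i}\mathbb E_{\tilde Z^i,U^i}\sqrt{2I^{\tilde Z^i,U^i}(W;V_i)}+\frac1{nK}\sum_{i,j}\mathbb E_{\tilde Z^i,V_i}\sqrt{2I^{\tilde Z^i,V_i}(W;U^{i,V_i}_j)},$$ and $B'_{\mathrm{CMI}}$ is the same expression with the second term replaced by $\frac1{nK}\sum_{i,j}\mathbb E_{\tilde Z_{i,j}}\sqrt{2I^{\tilde Z_{i,j}}(W;U_{i,j})}$. **Claim.** For every algorithm, $$|\mathrm{gen}|\le B_{\mathbb W},\qquad |\mathrm{gen}|\le B_{\mathrm{CMI}},\qquad |\mathrm{gen}|\le B'_{\mathrm{CMI}}.$$ If moreover the output law of the algorithm depends on the tree only through the data points $z_{i,j}$, then the Wasserstein bound implies the CMI bounds: $$|\mathrm{gen}|\le B_{\mathbb W}\le B_{\mathrm{CMI}}\qquad\text{and}\qquad |\mathrm{gen}|\le B_{\mathbb W}\le B'_{\mathrm{CMI}}.$$ -/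

import Mathlib

open MeasureTheory ProbabilityTheory InformationTheory
open scoped ENNReal

namespace TwoLevelFL

/-! ### Wasserstein distance and conditional mutual information -/

/-- The discrete metric `ρ(x, y) = 1` if `x ≠ y` and `ρ(x, x) = 0`. -/
noncomputable def discreteDist {X : Type*} (x y : X) : ℝ≥0∞ :=
  open scoped Classical in if x = y then 0 else 1

/-- The order one Wasserstein distance, as the optimal transport cost for the metric `ρ`: the
infimum of `E_π [ρ(X, Y)]` over all couplings `π` of `P` and `Q`. -/
noncomputable def wasserstein {X : Type*} [MeasurableSpace X] (ρ : X → X → ℝ≥0∞)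
    (P Q : Measure X) : ℝ≥0∞ :=
  ⨅ π ∈ {π : Measure (X × X) | π.map Prod.fst = P ∧ π.map Prod.snd = Q}, ∫⁻ p, ρ p.1 p.2 ∂π

section Conditional

variable {Ω 𝒲 S T : Type*} [MeasurableSpace Ω] [MeasurableSpace 𝒲] [MeasurableSpace S]
  [MeasurableSpace T] [StandardBorelSpace 𝒲] [Nonempty 𝒲]

/-- `E_{X, Y} 𝕎(P_{W | X, Y}, P_{W | X})`, where `P_{W | ·}` are the regular conditional laws and
the Wasserstein distance is taken for the discrete metric on the values of `W`. -/
noncomputable def expectedWasserstein (P : Measure Ω) [IsFiniteMeasure P]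
    (W : Ω → 𝒲) (Y : Ω → T) (X : Ω → S) : ℝ≥0∞ :=
  ∫⁻ ω, wasserstein discreteDist
    (condDistrib W (fun ω' => (X ω', Y ω')) P (X ω, Y ω)) (condDistrib W X P (X ω)) ∂P

/-- The disintegrated conditional mutual information
`I^x(W; Y) = D_KL(P_{W, Y | X = x} ‖ P_{W | X = x} ⊗ P_{Y | X = x})`. -/
noncomputable def disintegratedCMI [StandardBorelSpace T] [Nonempty T] (P : Measure Ω)
    [IsFiniteMeasure P] (W : Ω → 𝒲) (Y : Ω → T) (X : Ω → S) (x : S) : ℝ≥0∞ :=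
  klDiv (condDistrib (fun ω => (W ω, Y ω)) X P x)
    ((condDistrib W X P x).prod (condDistrib Y X P x))

/-- `E_X √(2 I^X(W; Y))`. -/
noncomputable def expectedSqrtCMI [StandardBorelSpace T] [Nonempty T] (P : Measure Ω)
    [IsFiniteMeasure P] (W : Ω → 𝒲) (Y : Ω → T) (X : Ω → S) : ℝ≥0∞ :=
  ∫⁻ ω, (2 * disintegratedCMI P W Y X (X ω)) ^ (1 / 2 : ℝ) ∂P

end Conditional

/-! ### The two-level sampling model

`D` is the meta-distribution on clients, a client is a distribution on data points. There are `K`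
clients with `n` data points each. -/

section Model

variable {Z 𝒲 : Type*} [MeasurableSpace Z] [MeasurableSpace 𝒲]

lemma measurable_pi_const (ι : Type*) [Fintype ι] :
    Measurable fun m : ProbabilityMeasure Z => Measure.pi fun _ : ι => (m : Measure Z) := by
  refine Measurable.measure_of_isPiSystem_of_isProbabilityMeasure generateFrom_pi.symm
    isPiSystem_pi ?_
  rintro _ ⟨s, hs, rfl⟩
  simp only [Measure.pi_pi]
  refine Finset.measurable_prod _ fun i _ => ?_
  exact (Measure.measurable_coe (hs i (Set.mem_univ i))).comp measurable_subtype_coe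

/-- Independent sampling of a family of data points, indexed by `ι`, from one client. -/
noncomputable def iidKernel (ι : Type*) [Fintype ι] : Kernel (ProbabilityMeasure Z) (ι → Z) where
  toFun m := Measure.pi fun _ : ι => (m : Measure Z)
  measurable' := measurable_pi_const ι

instance (ι : Type*) [Fintype ι] : IsMarkovKernel (iidKernel (Z := Z) ι) :=
  ⟨fun m => by change IsProbabilityMeasure (Measure.pi fun _ : ι => (m : Measure Z)); infer_instance⟩

/-- A realization of the tree: for each of the `K` positions, the client and its `n` data points. -/
abbrev Tree (K n : ℕ) (Z : Type*) [MeasurableSpace Z] : Type _ :=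
  Fin K → ProbabilityMeasure Z × (Fin n → Z)

/-- The law of the tree: the clients are drawn independently from `D`, and the data points of each
client are drawn independently from that client. -/
noncomputable def treeLaw (K n : ℕ) (D : Measure (ProbabilityMeasure Z)) [IsProbabilityMeasure D] :
    Measure (Tree K n Z) :=
  Measure.pi fun _ : Fin K => D ⊗ₘ iidKernel (Fin n)

/-- The population risk `L(w) = E_{μ ∼ D} E_{z ∼ μ} ℓ(w, z)`. -/
noncomputable def popRisk (D : Measure (ProbabilityMeasure Z)) (loss : 𝒲 → Z → ℝ) (w : 𝒲) : ℝ :=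
  ∫ m, ∫ z, loss w z ∂(m : Measure Z) ∂D

/-- The empirical risk, the average of the loss over all `nK` data points. -/
noncomputable def empRisk {K n : ℕ} (loss : 𝒲 → Z → ℝ) (w : 𝒲) (t : Tree K n Z) : ℝ :=
  1 / ((K : ℝ) * n) * ∑ i : Fin K, ∑ j : Fin n, loss w ((t i).2 j)

/-- The expected generalization error of the algorithm `A`, a kernel from trees to hypotheses. -/
noncomputable def genError {K n : ℕ} (D : Measure (ProbabilityMeasure Z)) [IsProbabilityMeasure D]
    (A : Kernel (Tree K n Z) 𝒲) (loss : 𝒲 → Z → ℝ) : ℝ :=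
  ∫ p, (popRisk D loss p.2 - empRisk loss p.2 p.1) ∂(treeLaw K n D ⊗ₘ A)

/-- The algorithm only uses the data points of the tree, and not the clients themselves. -/
def UsesOnlyData {K n : ℕ} (A : Kernel (Tree K n Z) 𝒲) : Prop :=
  ∀ t t' : Tree K n Z, (∀ i, (t i).2 = (t' i).2) → A t = A t'

/-! ### Superclients and supersamples -/

/-- A uniform bit. -/
noncomputable def coin : Measure Bool := (PMF.uniformOfFintype Bool).toMeasure

instance : IsProbabilityMeasure coin := by unfold coin; infer_instance

/-- The sample space of the supersample. The first component holds, for every `i` and every bit `b`,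
the client `μ^{i,b}` and its samples `Z^{i,b}_{j,c}`, for `j` in `Fin n` and a bit `c`; the second
one holds the bits `V_i`; the third one holds the bits `U^{i,b}_j`. -/
abbrev Super (K n : ℕ) (Z : Type*) [MeasurableSpace Z] : Type _ :=
  (Fin K → Bool → ProbabilityMeasure Z × (Fin n × Bool → Z)) ×
    ((Fin K → Bool) × (Fin K → Bool → Fin n → Bool))

/-- The law of the supersample: the clients `μ^{i,b}` are i.i.d. from `D`, the samples `Z^{i,b}_{j,c}`
are i.i.d. from `μ^{i,b}`, and all the bits are uniform and independent of everything else. -/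
noncomputable def superLaw (K n : ℕ) (D : Measure (ProbabilityMeasure Z)) [IsProbabilityMeasure D] :
    Measure (Super K n Z) :=
  (Measure.pi fun _ : Fin K => Measure.pi fun _ : Bool => D ⊗ₘ iidKernel (Fin n × Bool)).prod
    ((Measure.pi fun _ : Fin K => coin).prod
      (Measure.pi fun _ : Fin K => Measure.pi fun _ : Bool => Measure.pi fun _ : Fin n => coin))

instance (K n : ℕ) (D : Measure (ProbabilityMeasure Z)) [IsProbabilityMeasure D] :
    IsProbabilityMeasure (superLaw K n D) := by unfold superLaw; infer_instance

/-- The training tree: the `i`-th client is `μ^{i,V_i}`, and its `j`-th data point is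
`Z^{i,V_i}_{j,U^{i,V_i}_j}`. -/
def selectedTree {K n : ℕ} (s : Super K n Z) : Tree K n Z := fun i =>
  ((s.1 i (s.2.1 i)).1, fun j => (s.1 i (s.2.1 i)).2 (j, s.2.2 i (s.2.1 i) j))

lemma measurable_selectedTree (K n : ℕ) : Measurable (selectedTree (K := K) (n := n) (Z := Z)) := by
  have key : ∀ {α γ : Type _} [MeasurableSpace α] [MeasurableSpace γ] (f : Bool → α → γ)
      (b : α → Bool), (∀ c, Measurable (f c)) → Measurable b → Measurable fun a => f (b a) a := by
    intro α γ _ _ f b hf hb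
    exact (measurable_from_prod_countable_right (f := fun p : Bool × α => f p.1 p.2) hf).comp
      (hb.prodMk measurable_id)
  refine measurable_pi_lambda _ fun i => Measurable.prodMk ?_ (measurable_pi_lambda _ fun j => ?_)
  · exact key (fun c (s : Super K n Z) => (s.1 i c).1) (fun s => s.2.1 i)
      (fun c => by fun_prop) (by fun_prop)
  · refine key (fun c (s : Super K n Z) => (s.1 i c).2 (j, s.2.2 i c j)) (fun s => s.2.1 i)
      (fun c => ?_) (by fun_prop)
    exact key (fun d (s : Super K n Z) => (s.1 i c).2 (j, d)) (fun s => s.2.2 i c j)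
      (fun d => by fun_prop) (by fun_prop)

/-- The joint law of the supersample and of the hypothesis trained on the selected tree. -/
noncomputable def jointLaw {K n : ℕ} (D : Measure (ProbabilityMeasure Z)) [IsProbabilityMeasure D]
    (A : Kernel (Tree K n Z) 𝒲) : Measure (Super K n Z × 𝒲) :=
  superLaw K n D ⊗ₘ A.comap selectedTree (measurable_selectedTree K n)

instance {K n : ℕ} (D : Measure (ProbabilityMeasure Z)) [IsProbabilityMeasure D]
    (A : Kernel (Tree K n Z) 𝒲) [IsMarkovKernel A] : IsProbabilityMeasure (jointLaw D A) := by
  unfold jointLaw; infer_instance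

/-! Random variables on `Super K n Z × 𝒲`. -/

variable {K n : ℕ}

/-- The hypothesis `W`. -/
def hyp (ω : Super K n Z × 𝒲) : 𝒲 := ω.2

/-- The `i`-th superclient, the pair `(μ^{i,0}, μ^{i,1})`. -/
def clientPair (i : Fin K) (ω : Super K n Z × 𝒲) : Bool → ProbabilityMeasure Z :=
  fun b => (ω.1.1 i b).1

/-- The supersample `Z^i` of the `i`-th superclient, all `Z^{i,b}_{j,c}`. -/
def sampleOf (i : Fin K) (ω : Super K n Z × 𝒲) : Bool → Fin n × Bool → Z :=
  fun b => (ω.1.1 i b).2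

/-- The bit `V_i` that selects the participating client. -/
def bitV (i : Fin K) (ω : Super K n Z × 𝒲) : Bool := ω.1.2.1 i

/-- The bits `U^i`, all `U^{i,b}_j`. -/
def bitsU (i : Fin K) (ω : Super K n Z × 𝒲) : Bool → Fin n → Bool := ω.1.2.2 i

/-- The bit `U^{i,V_i}_j` that selects the `j`-th data point of the participating client. -/
def selectedBit (i : Fin K) (j : Fin n) (ω : Super K n Z × 𝒲) : Bool := bitsU i ω (bitV i ω) j

/-- The pair `(Z^{i,V_i}_{j,0}, Z^{i,V_i}_{j,1})`, the `j`-th pair of the participating client. -/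
def leafPair (i : Fin K) (j : Fin n) (ω : Super K n Z × 𝒲) : Bool → Z :=
  fun c => sampleOf i ω (bitV i ω) (j, c)

/-! ### The bounds -/

variable [StandardBorelSpace 𝒲] [Nonempty 𝒲] (D : Measure (ProbabilityMeasure Z))
  [IsProbabilityMeasure D] (A : Kernel (Tree K n Z) 𝒲) [IsMarkovKernel A]

/-- The hierarchical Wasserstein bound for two levels, Lipschitz constant `1` and the discrete
metric: twice the sum over the levels of the averages over the nodes of
`E 𝕎(P_{W | node pair, node bit}, P_{W | node pair})`. -/
noncomputable def wassersteinBound : ℝ≥0∞ :=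
  2 * ((K : ℝ≥0∞)⁻¹ * ∑ i : Fin K,
        expectedWasserstein (jointLaw D A) hyp (bitV i) (clientPair i)
    + ((K : ℝ≥0∞) * n)⁻¹ * ∑ i : Fin K, ∑ j : Fin n,
        expectedWasserstein (jointLaw D A) hyp (selectedBit i j) (leafPair i j))

/-- Participation gap: `1/K ∑_i E_{Z^i, U^i} √(2 I^{Z^i, U^i}(W; V_i))`. -/
noncomputable def participationCMI : ℝ≥0∞ :=
  (K : ℝ≥0∞)⁻¹ * ∑ i : Fin K,
    expectedSqrtCMI (jointLaw D A) hyp (bitV i) (fun ω => (sampleOf i ω, bitsU i ω))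

/-- Out-of-sample gap: `1/(nK) ∑_{i,j} E_{Z^i, V_i} √(2 I^{Z^i, V_i}(W; U^{i,V_i}_j))`. -/
noncomputable def outOfSampleCMI : ℝ≥0∞ :=
  ((K : ℝ≥0∞) * n)⁻¹ * ∑ i : Fin K, ∑ j : Fin n,
    expectedSqrtCMI (jointLaw D A) hyp (selectedBit i j) (fun ω => (sampleOf i ω, bitV i ω))

/-- The out-of-sample term with conditioning on the single pair `Z^{i,V_i}_j` only. -/
noncomputable def outOfSampleLeafCMI : ℝ≥0∞ :=
  ((K : ℝ≥0∞) * n)⁻¹ * ∑ i : Fin K, ∑ j : Fin n,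
    expectedSqrtCMI (jointLaw D A) hyp (selectedBit i j) (leafPair i j)

end Model

end TwoLevelFL

/-! The generalization error telescopes through the risk of the training clients: it is the average
of the gaps "population risk minus risk of client i" plus the average of the gaps "risk of client i
minus loss at its j-th data point" (`genError_eq`). The supersample turns each gap into an
expectation E[f(X, W) σ(Y)], where Y is a uniform bit independent of X, σ(Y) = ±1 and |f| ≤ 1. Here
f is the difference of the values at the two candidates between which Y chooses, and the sign always
produces "unselected minus selected". This rests on two facts about ghost variables: given the
training tree, an unselected data point of a participating client is a fresh sample of that client,
and a nonparticipating client is a fresh draw from D. In both cases the ghost is independent of W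
given the tree.

Such an expectation is bounded in two ways. Subtracting the integral against P_{W|X} changes
nothing, because the sign has mean zero given X, so Kantorovich duality gives 2 E 𝕎(P_{W|X,Y},
P_{W|X}). Alternatively, given X the function f σ has mean zero under P_{W|X} ⊗ P_{Y|X}, so
Pinsker's inequality gives E √(2 I^X(W; Y)). The client gap has two representations of this kind:
with the risks of the two clients, X is the pair of clients; with the losses at their unselected
data points, X = (Z^i, U^i). Hence both bounds hold for every algorithm.

The comparison of the bounds comes from the converse of the duality step. The bit is uniform, so
P_{W|X} is the midpoint of the two laws P_{W|X,Y=b}, and one set, where the density of P_{W|X,Y=1}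
with respect to P_{W|X} is at least 1, is optimal for both values of the bit, up to complement. The
Wasserstein term is therefore itself at most some E[f(X, W) σ(Y)]
(`exists_two_mul_expectedWasserstein_le`), to which Pinsker's inequality applies. At the data level
f is a function of the CMI conditioning variables and nothing more is needed. At the client level f
sees the clients, whereas the CMI term conditions on (Z^i, U^i) only. If the algorithm uses only the
data, then W depends on the i-th block only through Z^i, U^i, V_i
(`exists_kernel_jointLaw_map_block`), and Pinsker's inequality can be applied with the clients
frozen in f (`ofReal_integral_mul_bitSign_le_expectedSqrtCMI`). -/

namespace TwoLevelFL

/-! ### Duality and couplings for the discrete metric -/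

section Wasserstein

variable {X : Type*} [MeasurableSpace X]

lemma integrable_of_abs_le_one {P : Measure X} [IsFiniteMeasure P] {f : X → ℝ}
    (hf : Measurable f) (hb : ∀ x, |f x| ≤ 1) : Integrable f P :=
  Integrable.of_bound hf.aestronglyMeasurable 1 (ae_of_all _ hb)

lemma ofReal_integral_le_lintegral_ofReal {P : Measure X} {f : X → ℝ} :
    ENNReal.ofReal (∫ x, f x ∂P) ≤ ∫⁻ x, ENNReal.ofReal (f x) ∂P := by
  by_cases hf : Integrable f P
  · rw [integral_eq_lintegral_pos_part_sub_lintegral_neg_part hf]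
    refine (ENNReal.ofReal_le_ofReal (sub_le_self _ ENNReal.toReal_nonneg)).trans ?_
    exact ENNReal.ofReal_toReal_le
  · simp [integral_undef hf]

/-- Easy half of Kantorovich duality for the discrete metric. -/
theorem ofReal_integral_sub_integral_le_wasserstein {P Q : Measure X} [IsProbabilityMeasure P]
    [IsProbabilityMeasure Q] {f : X → ℝ} (hf : Measurable f) (hb : ∀ x, |f x| ≤ 1) :
    ENNReal.ofReal (∫ x, f x ∂P - ∫ x, f x ∂Q) ≤ 2 * wasserstein discreteDist P Q := by
  unfold wasserstein
  rw [ENNReal.mul_iInf_of_ne (by simp) (by simp)]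
  refine le_iInf fun π => ?_
  rw [ENNReal.mul_iInf_of_ne (by simp) (by simp)]
  refine le_iInf fun hπ => ?_
  obtain ⟨h1, h2⟩ := hπ
  have : IsProbabilityMeasure π := by
    have : IsProbabilityMeasure (π.map Prod.fst) := by rw [h1]; infer_instance
    exact Measure.isProbabilityMeasure_of_map Prod.fst
  rw [← h1, ← h2, integral_map (by fun_prop) hf.aestronglyMeasurable,
    integral_map (by fun_prop) hf.aestronglyMeasurable, ← integral_sub,
    ← lintegral_const_mul' _ _ (by simp)]
  -- The constant 2 is the largest possible oscillation of a function with values in [-1, 1].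
  · refine ofReal_integral_le_lintegral_ofReal.trans (lintegral_mono fun p => ?_)
    unfold discreteDist
    split_ifs with h
    · simp [h]
    · have h1 := abs_le.1 (hb p.1)
      have h2 := abs_le.1 (hb p.2)
      rw [mul_one]
      exact ENNReal.ofReal_le_of_le_toReal (by simp; linarith)
  · exact integrable_of_abs_le_one (hf.comp measurable_fst) fun p => hb p.1
  · exact integrable_of_abs_le_one (hf.comp measurable_snd) fun p => hb p.2

/-- The coupling that keeps the common part of `P` and `Q` on the diagonal. -/
theorem wasserstein_le_of_restrict_le {P Q : Measure X} [IsProbabilityMeasure P]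
    [IsProbabilityMeasure Q] {B : Set X} (hB : MeasurableSet B)
    (h1 : Q.restrict B ≤ P.restrict B) (h2 : P.restrict Bᶜ ≤ Q.restrict Bᶜ) :
    wasserstein discreteDist P Q ≤ P B - Q B := by
  -- R is the minimum of P and Q. The excesses P' = P - R and Q' = Q - R have the same mass d, and
  -- the coupling is R on the diagonal plus the normalized product of the excesses, whose cost is at
  -- most d.
  set R := P.restrict Bᶜ + Q.restrict B with hR
  set P' := P.restrict B - Q.restrict B with hP'
  set Q' := Q.restrict Bᶜ - P.restrict Bᶜ with hQ'
  have hPR : R + P' = P := by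
    rw [hR, hP', add_assoc, add_comm (Q.restrict B), Measure.sub_add_cancel_of_le h1, add_comm,
      Measure.restrict_add_restrict_compl hB]
  have hQR : R + Q' = Q := by
    rw [hR, hQ', add_comm (P.restrict Bᶜ), add_assoc, add_comm (P.restrict Bᶜ),
      Measure.sub_add_cancel_of_le h2, Measure.restrict_add_restrict_compl hB]
  have hRle : R ≤ P := hPR ▸ Measure.le_add_right le_rfl
  have hRfin : IsFiniteMeasure R := isFiniteMeasure_of_le P hRle
  have hP'fin : IsFiniteMeasure P' := by
    refine isFiniteMeasure_of_le P ?_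
    conv_rhs => rw [← hPR]
    exact Measure.le_add_left le_rfl
  have hQ'fin : IsFiniteMeasure Q' := by
    refine isFiniteMeasure_of_le Q ?_
    conv_rhs => rw [← hQR]
    exact Measure.le_add_left le_rfl
  have eP : R Set.univ + P' Set.univ = 1 := by
    rw [← Measure.add_apply, hPR, measure_univ]
  have eQ : R Set.univ + Q' Set.univ = 1 := by
    rw [← Measure.add_apply, hQR, measure_univ]
  have hPQ : P' Set.univ = Q' Set.univ :=
    (ENNReal.add_right_inj (measure_ne_top R _)).1 (eP.trans eQ.symm)
  set d := P' Set.univ with hd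
  have hdval : d = P B - Q B := by
    have : P' Set.univ + (Q.restrict B) Set.univ = (P.restrict B) Set.univ := by
      rw [← Measure.add_apply, hP', Measure.sub_add_cancel_of_le h1]
    simp only [Measure.restrict_apply_univ] at this
    exact ENNReal.eq_sub_of_add_eq (measure_ne_top _ _) this
  have hdtop : d ≠ ∞ := measure_ne_top _ _
  -- For d = 0 the scalar is ∞ · 0 = 0, which is harmless since the excess vanishes too.
  have cancelP : (d⁻¹ * Q' Set.univ) • P' = P' := by
    rw [← hPQ]
    by_cases h0 : d = 0
    · have : P' = 0 := Measure.measure_univ_eq_zero.1 h0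
      simp [this]
    · rw [ENNReal.inv_mul_cancel h0 hdtop, one_smul]
  have cancelQ : (d⁻¹ * P' Set.univ) • Q' = Q' := by
    by_cases h0 : d = 0
    · have : Q' = 0 := Measure.measure_univ_eq_zero.1 (hPQ ▸ h0)
      simp [this]
    · rw [← hd, ENNReal.inv_mul_cancel h0 hdtop, one_smul]
  have hdiag : Measurable fun x : X => (x, x) := by fun_prop
  have hmem : R.map (fun x => (x, x)) + d⁻¹ • P'.prod Q' ∈
      {π : Measure (X × X) | π.map Prod.fst = P ∧ π.map Prod.snd = Q} := by
    constructor
    · rw [Measure.map_add _ _ measurable_fst, Measure.map_map measurable_fst hdiag,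
        Measure.map_smul, Measure.map_fst_prod, smul_smul, cancelP]
      exact (congrArg (· + P') Measure.map_id).trans hPR
    · rw [Measure.map_add _ _ measurable_snd, Measure.map_map measurable_snd hdiag,
        Measure.map_smul, Measure.map_snd_prod, smul_smul, cancelQ]
      exact (congrArg (· + Q') Measure.map_id).trans hQR
  refine (iInf₂_le _ hmem).trans ?_
  · rw [lintegral_add_measure, lintegral_smul_measure]
    have e1 : ∫⁻ p, discreteDist p.1 p.2 ∂(R.map fun x => (x, x)) = 0 := by
      -- The diagonal need not be measurable in a general space, so only the inequality for
      -- pushforwards is available; it suffices here.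
      refine le_antisymm ((lintegral_map_le _ _).trans ?_) bot_le
      simp [discreteDist]
    have e2 : ∫⁻ p, discreteDist p.1 p.2 ∂(P'.prod Q') ≤ d * d := by
      calc _ ≤ ∫⁻ _, 1 ∂(P'.prod Q') := by
            refine lintegral_mono fun p => ?_
            unfold discreteDist; split_ifs <;> simp
        _ = d * d := by
            rw [lintegral_one, ← Set.univ_prod_univ, Measure.prod_prod, ← hPQ]
    rw [e1, zero_add, smul_eq_mul, ← hdval]
    calc _ ≤ d⁻¹ * (d * d) := by gcongr
      _ ≤ d := by
        by_cases h0 : d = 0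
        · simp [h0]
        · rw [← mul_assoc, ENNReal.inv_mul_cancel h0 hdtop, one_mul]

end Wasserstein

/-! ### Pinsker's inequality -/

/-- The derivative is log r + 1/r - 1 ≥ 0. Since the function vanishes at 1, it has the sign of r -
1; up to a factor 4 it is the derivative used in `three_mul_sq_le_klFun`. -/
lemma monotoneOn_add_one_mul_log_sub :
    MonotoneOn (fun r : ℝ => (r + 1) * Real.log r - 2 * (r - 1)) (Set.Ioi 0) := by
  have hd : ∀ r ∈ Set.Ioi (0 : ℝ), HasDerivAt (fun r : ℝ => (r + 1) * Real.log r - 2 * (r - 1))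
      (1 * Real.log r + (r + 1) * r⁻¹ - 2 * 1) r := fun r hr =>
    (((hasDerivAt_id r).add_const 1).mul (Real.hasDerivAt_log (ne_of_gt hr))).sub
      (((hasDerivAt_id r).sub_const 1).const_mul 2)
  refine monotoneOn_of_hasDerivWithinAt_nonneg (convex_Ioi 0)
    (fun r hr => (hd r hr).continuousAt.continuousWithinAt)
    (fun r hr => (hd r (interior_subset hr)).hasDerivWithinAt) fun r hr => ?_
  have hr0 : 0 < r := interior_subset hr
  have := Real.one_sub_inv_le_log_of_pos hr0
  rw [add_mul, mul_inv_cancel₀ hr0.ne']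
  linarith

/-- The difference of the two sides vanishes at 1, decreases before it and increases after it. This
is the pointwise form of Pinsker's inequality: the weight 2r + 4 has integral 6 when r is a
probability density, which yields the sharp constant. -/
lemma three_mul_sq_le_klFun {r : ℝ} (hr : 0 ≤ r) :
    3 * (r - 1) ^ 2 ≤ (2 * r + 4) * klFun r := by
  set g : ℝ → ℝ := fun r => (2 * r + 4) * klFun r - 3 * (r - 1) ^ 2 with hg
  have hcont : Continuous g := by
    have := continuous_klFun
    fun_prop
  have hd : ∀ r : ℝ, 0 < r →
      HasDerivAt g (4 * ((r + 1) * Real.log r - 2 * (r - 1))) r := fun r hr => by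
    have h := ((((hasDerivAt_id r).const_mul 2).add_const 4).mul (hasDerivAt_klFun hr.ne')).sub
      ((((hasDerivAt_id r).sub_const 1).pow 2).const_mul 3)
    refine h.congr_deriv ?_
    simp only [klFun_apply, id]
    push_cast
    ring
  have h1 : g 1 = 0 := by simp [hg, klFun_one]
  have hone : (1 : ℝ) ∈ Set.Ioi (0 : ℝ) := Set.mem_Ioi.2 one_pos
  suffices 0 ≤ g r by simp only [hg] at this; linarith
  rw [← h1]
  rcases le_total r 1 with h | h
  · refine antitoneOn_of_hasDerivWithinAt_nonpos (convex_Icc 0 1) hcont.continuousOn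
      (fun x hx => (hd x ?_).hasDerivWithinAt) (fun x hx => ?_) ⟨hr, h⟩ ⟨zero_le_one, le_rfl⟩ h
    · rw [interior_Icc] at hx; exact hx.1
    · rw [interior_Icc] at hx
      have := monotoneOn_add_one_mul_log_sub (Set.mem_Ioi.2 hx.1) hone hx.2.le
      simp only [Real.log_one] at this
      linarith
  · refine monotoneOn_of_hasDerivWithinAt_nonneg (convex_Ici 1) hcont.continuousOn
      (fun x hx => (hd x ?_).hasDerivWithinAt) (fun x hx => ?_) Set.self_mem_Ici h h
    · rw [interior_Ici] at hx; exact one_pos.trans hx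
    · rw [interior_Ici] at hx
      have := monotoneOn_add_one_mul_log_sub hone (Set.mem_Ioi.2 (one_pos.trans hx)) hx.le
      simp only [Real.log_one] at this
      linarith

section Pinsker

variable {X : Type*} [MeasurableSpace X]

/-- Pinsker's inequality, in its variational form. -/
theorem ofReal_integral_sub_integral_le_sqrt_klDiv {μ ν : Measure X} [IsProbabilityMeasure μ]
    [IsProbabilityMeasure ν] {f : X → ℝ} (hf : Measurable f) (hb : ∀ x, |f x| ≤ 1) :
    ENNReal.ofReal (∫ x, f x ∂μ - ∫ x, f x ∂ν) ≤ (2 * klDiv μ ν) ^ (1 / 2 : ℝ) := by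
  by_cases htop : klDiv μ ν = ∞
  · simp [htop]
  obtain ⟨hac, hint⟩ := klDiv_ne_top_iff.1 htop
  set r : X → ℝ := fun x => (μ.rnDeriv ν x).toReal with hr
  have hrm : Measurable r := (Measure.measurable_rnDeriv μ ν).ennreal_toReal
  have hrint : Integrable r ν := Measure.integrable_toReal_rnDeriv
  have hrint1 : ∫ x, r x ∂ν = 1 := by
    rw [hr, Measure.integral_toReal_rnDeriv hac]; simp
  have hr0 : ∀ x, 0 ≤ r x := fun x => ENNReal.toReal_nonneg
  have hkint : Integrable (fun x => klFun (r x)) ν := (integrable_klFun_rnDeriv_iff hac).2 hint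
  set k := ∫ x, klFun (r x) ∂ν with hk
  have hkl : (klDiv μ ν).toReal = k := toReal_klDiv_eq_integral_klFun hac
  set δ := ∫ x, |r x - 1| ∂ν with hδ
  have hδint : Integrable (fun x => |r x - 1|) ν := (hrint.sub (integrable_const 1)).abs
  have hδ0 : 0 ≤ δ := integral_nonneg fun x => abs_nonneg _
  have hfint : Integrable (fun x => r x • f x) ν :=
    hrint.mul_bdd (c := 1) hf.aestronglyMeasurable (ae_of_all _ hb)
  have h1 : ∫ x, f x ∂μ - ∫ x, f x ∂ν ≤ δ := by
    rw [← integral_rnDeriv_smul hac, ← integral_sub]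
    · refine integral_mono (hfint.sub (integrable_of_abs_le_one hf hb)) hδint fun x => ?_
      calc r x • f x - f x = (r x - 1) * f x := by rw [smul_eq_mul]; ring
        _ ≤ |(r x - 1) * f x| := le_abs_self _
        _ = |r x - 1| * |f x| := abs_mul _ _
        _ ≤ |r x - 1| := mul_le_of_le_one_right (abs_nonneg _) (hb x)
    · exact hfint
    · exact integrable_of_abs_le_one hf hb
  have h2 : δ ^ 2 ≤ 2 * k := by
    rcases hδ0.eq_or_lt with h0 | hpos
    · rw [← h0]
      have : 0 ≤ k := integral_nonneg fun x => klFun_nonneg (hr0 x)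
      simpa using this
    -- A pointwise arithmetic-geometric mean inequality with the optimal weight replaces
    -- Cauchy–Schwarz. Integration gives 2δ² ≤ δ² + 2k.
    have key : ∀ x, 2 * δ * |r x - 1| ≤ δ ^ 2 / 6 * (2 * r x + 4) + 2 * klFun (r x) := by
      intro x
      have hx := three_mul_sq_le_klFun (hr0 x)
      have hx0 := hr0 x
      have : (2 * r x + 4) * (2 * δ * |r x - 1|) ≤
          (2 * r x + 4) * (δ ^ 2 / 6 * (2 * r x + 4) + 2 * klFun (r x)) := by
        rw [← sq_abs] at hx
        nlinarith [sq_nonneg (δ * (2 * r x + 4) - 6 * |r x - 1|)]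
      exact le_of_mul_le_mul_left this (by linarith)
    have hI : ∫ x, 2 * δ * |r x - 1| ∂ν
        ≤ ∫ x, (δ ^ 2 / 6 * (2 * r x + 4) + 2 * klFun (r x)) ∂ν := by
      refine integral_mono (hδint.const_mul _) ?_ key
      exact (((hrint.const_mul 2).add (integrable_const 4)).const_mul _).add (hkint.const_mul 2)
    rw [integral_const_mul, integral_add, integral_const_mul, integral_const_mul,
      integral_add (hrint.const_mul 2) (integrable_const 4), integral_const_mul, hrint1] at hI
    · simp at hI
      nlinarith
    · exact ((hrint.const_mul 2).add (integrable_const 4)).const_mul _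
    · exact hkint.const_mul 2
  have h3 : ENNReal.ofReal (δ ^ 2) ≤ 2 * klDiv μ ν := by
    rw [← ENNReal.ofReal_toReal htop, hkl, ← ENNReal.ofReal_ofNat 2,
      ← ENNReal.ofReal_mul (by norm_num)]
    exact ENNReal.ofReal_le_ofReal h2
  calc ENNReal.ofReal (∫ x, f x ∂μ - ∫ x, f x ∂ν) ≤ ENNReal.ofReal δ := ENNReal.ofReal_le_ofReal h1
    _ = (ENNReal.ofReal (δ ^ 2)) ^ (1 / 2 : ℝ) := by
      rw [ENNReal.ofReal_rpow_of_nonneg (by positivity) (by norm_num), ← Real.sqrt_eq_rpow,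
        Real.sqrt_sq hδ0]
    _ ≤ _ := by gcongr

end Pinsker

/-! ### Uniform bits -/

/-- The sign `1` of `true` and `-1` of `false`. -/
def bitSign (b : Bool) : ℝ := if b then 1 else -1

lemma abs_bitSign (b : Bool) : |bitSign b| = 1 := by cases b <;> simp [bitSign]

lemma measurable_bitSign : Measurable bitSign := measurable_of_finite _

lemma coin_singleton (b : Bool) : coin {b} = 2⁻¹ := by
  rw [coin, PMF.toMeasure_apply_singleton _ _ (measurableSet_singleton b)]
  simp

lemma integral_coin (g : Bool → ℝ) : ∫ b, g b ∂coin = (g true + g false) / 2 := by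
  rw [integral_fintype (.of_finite)]
  simp [Measure.real, coin_singleton]
  ring

lemma integral_bitSign_coin : ∫ b, bitSign b ∂coin = 0 := by
  simp [integral_coin, bitSign]

lemma abs_mul_bitSign_le_one {a : ℝ} (ha : |a| ≤ 1) (b : Bool) : |a * bitSign b| ≤ 1 := by
  rwa [abs_mul, abs_bitSign, mul_one]

/-! ### Integrals of bounded functions against kernels -/

section KernelIntegral

variable {A B : Type*} [MeasurableSpace A] [MeasurableSpace B] {κ : Kernel A B} [IsMarkovKernel κ]
  {g : A × B → ℝ}

lemma measurable_integral_kernel (hg : Measurable g) : Measurable fun a => ∫ b, g (a, b) ∂(κ a) :=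
  (hg.stronglyMeasurable.integral_kernel_prod_right' (κ := κ)).measurable

lemma abs_integral_le_one {μ : Measure B} [IsProbabilityMeasure μ] {g : B → ℝ}
    (hb : ∀ b, |g b| ≤ 1) : |∫ b, g b ∂μ| ≤ 1 := by
  simpa using norm_integral_le_of_norm_le_const (μ := μ) (f := g) (C := 1) (ae_of_all _ hb)

end KernelIntegral

/-! ### Conditional laws given a uniform bit -/

section UniformBit

variable {Ω 𝒲 S S' : Type*} [MeasurableSpace Ω] [MeasurableSpace 𝒲] [MeasurableSpace S]
  [MeasurableSpace S'] {P : Measure Ω} [IsProbabilityMeasure P]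
  {W : Ω → 𝒲} {Y : Ω → Bool} {X : Ω → S}

lemma map_compProd_comap (μ : Measure S') [SFinite μ] (Q : Kernel S 𝒲) [IsSFiniteKernel Q]
    {g : S' → S} (hg : Measurable g) :
    (μ ⊗ₘ Q.comap g hg).map (Prod.map g id) = μ.map g ⊗ₘ Q := by
  ext s hs
  rw [Measure.map_apply (by fun_prop) hs, Measure.compProd_apply (hs.preimage (by fun_prop)),
    Measure.compProd_apply hs, lintegral_map (Kernel.measurable_kernel_prodMk_left hs) hg]
  rfl

/-- Reassociation: given X, the pair (Y, W) is obtained by tossing the coin and then applying Q.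
From this kernel all conditional laws given X are read off. -/
lemma map_prodMk_eq_compProd_const_compProd (hX : Measurable X) (hY : Measurable Y)
    (hW : Measurable W) {Q : Kernel (S × Bool) 𝒲} [IsSFiniteKernel Q]
    (h : P.map (fun ω => ((X ω, Y ω), W ω)) = ((P.map X).prod coin) ⊗ₘ Q) :
    P.map (fun ω => (X ω, (Y ω, W ω))) = P.map X ⊗ₘ (Kernel.const S coin ⊗ₖ Q) := by
  rw [← Measure.compProd_const] at h
  rw [← Measure.compProd_assoc', ← h, Measure.map_map (by fun_prop) (by fun_prop)]
  rfl

lemma integrable_integral_mul_bitSign (hX : Measurable X) (hY : Measurable Y)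
    {f : S × 𝒲 → ℝ} (hf : Measurable f) (hb : ∀ p, |f p| ≤ 1) (κ : Kernel (S × Bool) 𝒲)
    [IsMarkovKernel κ] :
    Integrable (fun ω => ∫ w, f (X ω, w) * bitSign (Y ω) ∂(κ (X ω, Y ω))) P := by
  have hs := measurable_bitSign
  have hfm : Measurable fun p : (S × Bool) × 𝒲 => f (p.1.1, p.2) * bitSign p.1.2 := by fun_prop
  exact integrable_of_abs_le_one ((measurable_integral_kernel (κ := κ) hfm).comp (hX.prodMk hY))
    fun ω => abs_integral_le_one fun w => abs_mul_bitSign_le_one (hb _) _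

section CondDistrib

variable [StandardBorelSpace 𝒲] [Nonempty 𝒲]

/-- Conditional laws are unique only almost everywhere. This expresses those of several functions of
V as images of one kernel, so that joint law and marginals can be compared at the same point x. -/
lemma condDistrib_comp_ae_eq {T : Type*} [MeasurableSpace T] [StandardBorelSpace T] [Nonempty T]
    {V : Ω → T} (hV : Measurable V) {K : Kernel S T} [IsFiniteKernel K]
    (hK : P.map (fun ω => (X ω, V ω)) = P.map X ⊗ₘ K) {g : T → 𝒲} (hg : Measurable g) :
    ∀ᵐ x ∂(P.map X), condDistrib (fun ω => g (V ω)) X P x = (K x).map g := by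
  filter_upwards [condDistrib_comp X hV.aemeasurable hg,
    condDistrib_ae_eq_of_measure_eq_compProd X hV.aemeasurable hK] with x h1 h2
  rw [← h2, ← Kernel.map_apply _ hg]
  exact h1

/-- The subtracted term contributes nothing: its inner integral is a function of X times the sign of
an independent uniform bit. It is inserted to compare the conditional laws with and without the bit.
-/
lemma integral_mul_bitSign_eq_integral_sub (hX : Measurable X) (hY : Measurable Y)
    (hW : Measurable W) (hXY : P.map (fun ω => (X ω, Y ω)) = (P.map X).prod coin)
    {f : S × 𝒲 → ℝ} (hf : Measurable f) (hb : ∀ p, |f p| ≤ 1) :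
    ∫ ω, f (X ω, W ω) * bitSign (Y ω) ∂P =
      ∫ ω, (∫ w, f (X ω, w) * bitSign (Y ω) ∂(condDistrib W (fun ω' => (X ω', Y ω')) P (X ω, Y ω))
        - ∫ w, f (X ω, w) * bitSign (Y ω) ∂(condDistrib W X P (X ω))) ∂P := by
  have hs := measurable_bitSign
  have hfm : Measurable fun p : (S × Bool) × 𝒲 => f (p.1.1, p.2) * bitSign p.1.2 := by fun_prop
  have hXYm : Measurable fun ω => (X ω, Y ω) := by fun_prop
  have hPX : IsProbabilityMeasure (P.map X) := Measure.isProbabilityMeasure_map hX.aemeasurable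
  have hPXY : IsProbabilityMeasure (P.map fun ω => (X ω, Y ω)) :=
    Measure.isProbabilityMeasure_map hXYm.aemeasurable
  have m1 := measurable_integral_kernel (κ := condDistrib W (fun ω' => (X ω', Y ω')) P) hfm
  have m2 := measurable_integral_kernel (κ := (condDistrib W X P).comap Prod.fst measurable_fst) hfm
  have i2 : Integrable (fun ω => ∫ w, f (X ω, w) * bitSign (Y ω) ∂(condDistrib W X P (X ω))) P :=
    integrable_integral_mul_bitSign hX hY hf hb ((condDistrib W X P).comap Prod.fst measurable_fst)
  rw [integral_sub (integrable_integral_mul_bitSign hX hY hf hb _) i2]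
  have e1 : ∫ ω, f (X ω, W ω) * bitSign (Y ω) ∂P = ∫ ω, ∫ w, f (X ω, w) * bitSign (Y ω)
      ∂(condDistrib W (fun ω' => (X ω', Y ω')) P (X ω, Y ω)) ∂P := by
    rw [← integral_map (φ := fun ω => ((X ω, Y ω), W ω))
      (f := fun p : (S × Bool) × 𝒲 => f (p.1.1, p.2) * bitSign p.1.2) (by fun_prop)
      hfm.aestronglyMeasurable, ← compProd_map_condDistrib hW.aemeasurable,
      Measure.integral_compProd 
        (integrable_of_abs_le_one hfm fun p => abs_mul_bitSign_le_one (hb _) _),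
      integral_map hXYm.aemeasurable m1.aestronglyMeasurable]
  have e2 : ∫ ω, ∫ w, f (X ω, w) * bitSign (Y ω) ∂(condDistrib W X P (X ω)) ∂P = 0 := by
    have := integral_map (μ := P) hXYm.aemeasurable m2.aestronglyMeasurable
    simp only [Kernel.comap_apply] at this
    rw [← this, hXY]
    simp_rw [integral_mul_const]
    rw [integral_prod_mul (fun x => ∫ w, f (x, w) ∂(condDistrib W X P x)) bitSign,
      integral_bitSign_coin, mul_zero]
  rw [e1, e2, sub_zero]

/-- A test function that changes sign with a uniform bit is controlled by the expected Wasserstein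
distance. -/
theorem ofReal_integral_mul_bitSign_le_expectedWasserstein (hX : Measurable X) (hY : Measurable Y)
    (hW : Measurable W) (hXY : P.map (fun ω => (X ω, Y ω)) = (P.map X).prod coin)
    {f : S × 𝒲 → ℝ} (hf : Measurable f) (hb : ∀ p, |f p| ≤ 1) :
    ENNReal.ofReal (∫ ω, f (X ω, W ω) * bitSign (Y ω) ∂P) ≤ 2 * expectedWasserstein P W Y X := by
  rw [integral_mul_bitSign_eq_integral_sub hX hY hW hXY hf hb, expectedWasserstein,
    ← lintegral_const_mul' _ _ (by simp)]
  refine ofReal_integral_le_lintegral_ofReal.trans (lintegral_mono fun ω => ?_)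
  exact ofReal_integral_sub_integral_le_wasserstein (by fun_prop)
    fun w => abs_mul_bitSign_le_one (hb _) _

/-- P_{W|X} is the midpoint of the laws given the two values of the bit. The doubled form avoids
halves in `ℝ≥0∞`. -/
lemma condDistrib_apply_add_self (hX : Measurable X) (hY : Measurable Y) (hW : Measurable W)
    {Q : Kernel (S × Bool) 𝒲} [IsMarkovKernel Q]
    (h : P.map (fun ω => ((X ω, Y ω), W ω)) = ((P.map X).prod coin) ⊗ₘ Q) :
    ∀ᵐ x ∂(P.map X), ∀ s, MeasurableSet s →
      condDistrib W X P x s + condDistrib W X P x s = Q (x, true) s + Q (x, false) s := by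
  filter_upwards [condDistrib_comp_ae_eq (hY.prodMk hW)
    (map_prodMk_eq_compProd_const_compProd hX hY hW h) measurable_snd] with x hx s hs
  rw [hx, Measure.map_apply measurable_snd hs, Kernel.compProd_apply (measurable_snd hs),
    lintegral_fintype]
  simp only [Kernel.const_apply, coin_singleton, Fintype.sum_bool, ← add_mul]
  rw [← mul_two, mul_assoc, ENNReal.mul_inv_cancel (by simp) (by simp), mul_one]
  rfl

/-- The expected Wasserstein distance is attained by a test function that changes sign with the
bit. -/
theorem exists_two_mul_expectedWasserstein_le (hX : Measurable X) (hY : Measurable Y)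
    (hW : Measurable W) (hXY : P.map (fun ω => (X ω, Y ω)) = (P.map X).prod coin) :
    ∃ f : S × 𝒲 → ℝ, Measurable f ∧ (∀ p, |f p| ≤ 1) ∧
      2 * expectedWasserstein P W Y X
        ≤ ENNReal.ofReal (∫ ω, f (X ω, W ω) * bitSign (Y ω) ∂P) := by
  set κ := condDistrib W (fun ω' => (X ω', Y ω')) P with hκ
  set N := condDistrib W X P with hN
  have hsum := condDistrib_apply_add_self hX hY hW (Q := κ)
    (by rw [← hXY, hκ, compProd_map_condDistrib hW.aemeasurable])
  let κ₁ : Kernel S 𝒲 := κ.comap (fun x => (x, true)) (by fun_prop)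
  -- The Hahn set of κ(x, true) - N(x), taken for all x at once: the kernel version of the density
  -- is jointly measurable, and so is the test function, which is 1 on B and -1 off it.
  let B : Set (S × 𝒲) := {p | 1 ≤ κ₁.rnDeriv N p.1 p.2}
  have hB : MeasurableSet B := measurableSet_le measurable_const (κ₁.measurable_rnDeriv N)
  classical
  let f : S × 𝒲 → ℝ := fun p => 2 * B.indicator 1 p - 1
  have hf : Measurable f := by
    have : Measurable (B.indicator (1 : S × 𝒲 → ℝ)) := measurable_one.indicator hB
    fun_prop
  have hb : ∀ p, |f p| ≤ 1 := fun p => by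
    by_cases hp : p ∈ B <;> simp [f, hp]; norm_num
  refine ⟨f, hf, hb, ?_⟩
  have hint : ∀ (m : Measure 𝒲) [IsProbabilityMeasure m] (x : S),
      ∫ w, f (x, w) ∂m = 2 * m.real (Prod.mk x ⁻¹' B) - 1 := by
    intro m _ x
    have : ∀ w, f (x, w) = 2 * (Prod.mk x ⁻¹' B).indicator 1 w - 1 := fun w => rfl
    simp_rw [this]
    rw [integral_sub _ (integrable_const _), integral_const_mul,
      integral_indicator_one (measurable_prodMk_left hB)]
    · simp
    · exact ((integrable_const (1 : ℝ)).indicator (measurable_prodMk_left hB)).const_mul 2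
  -- The nonnegativity is recorded because `ENNReal.ofReal` of an integral equals the integral of
  -- `ENNReal.ofReal` only for nonnegative integrands.
  have key : ∀ᵐ x ∂(P.map X), ∀ b : Bool,
      2 * wasserstein discreteDist (κ (x, b)) (N x) ≤
        ENNReal.ofReal (∫ w, f (x, w) * bitSign b ∂κ (x, b) - ∫ w, f (x, w) * bitSign b ∂N x) ∧
      0 ≤ ∫ w, f (x, w) * bitSign b ∂κ (x, b) - ∫ w, f (x, w) * bitSign b ∂N x := by
    filter_upwards [hsum] with x hx
    set C := Prod.mk x ⁻¹' B with hC
    have hCm : MeasurableSet C := measurable_prodMk_left hB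
    -- One half of a midpoint is dominated by twice the midpoint.
    have hac : κ₁ x ≪ N x := by
      refine Measure.AbsolutelyContinuous.mk fun s hs h0 => ?_
      have := hx s hs
      rw [h0, add_zero, eq_comm, add_eq_zero] at this
      exact this.1
    have hd : (N x).withDensity (κ₁.rnDeriv N x) = κ (x, true) := by
      rw [← Kernel.withDensity_apply _ (κ₁.measurable_rnDeriv N),
        Kernel.withDensity_rnDeriv_eq hac]
      rfl
    have ht1 : (N x).restrict C ≤ (κ (x, true)).restrict C := by
      refine Measure.le_iff.2 fun s hs => ?_
      rw [Measure.restrict_apply hs, Measure.restrict_apply hs, ← hd,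
        withDensity_apply _ (hs.inter hCm), ← setLIntegral_one]
      exact setLIntegral_mono' (hs.inter hCm) fun w hw => hw.2
    have ht2 : (κ (x, true)).restrict Cᶜ ≤ (N x).restrict Cᶜ := by
      refine Measure.le_iff.2 fun s hs => ?_
      rw [Measure.restrict_apply hs, Measure.restrict_apply hs, ← hd,
        withDensity_apply _ (hs.inter hCm.compl), ← setLIntegral_one]
      exact setLIntegral_mono' (hs.inter hCm.compl) fun w hw =>
        (not_le.1 (show ¬ (x, w) ∈ B from hw.2)).le
    -- Where one endpoint lies below the midpoint, the other lies above it. Thus the same C serves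
    -- the value `false`, with the roles of C and its complement exchanged.
    have hf2 : (N x).restrict Cᶜ ≤ (κ (x, false)).restrict Cᶜ := by
      refine Measure.le_iff.2 fun s hs => ?_
      have h1 := Measure.le_iff.1 ht2 s hs
      rw [Measure.restrict_apply hs, Measure.restrict_apply hs] at h1 ⊢
      have h2 := hx _ (hs.inter hCm.compl)
      have h3 : N x (s ∩ Cᶜ) + N x (s ∩ Cᶜ) ≤ N x (s ∩ Cᶜ) + κ (x, false) (s ∩ Cᶜ) := by
        rw [h2]; gcongr
      exact (ENNReal.add_le_add_iff_left (measure_ne_top _ _)).1 h3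
    have hf1 : (κ (x, false)).restrict C ≤ (N x).restrict C := by
      refine Measure.le_iff.2 fun s hs => ?_
      have h1 := Measure.le_iff.1 ht1 s hs
      rw [Measure.restrict_apply hs, Measure.restrict_apply hs] at h1 ⊢
      have h2 := hx _ (hs.inter hCm)
      have h3 : N x (s ∩ C) + κ (x, false) (s ∩ C) ≤ N x (s ∩ C) + N x (s ∩ C) := by
        rw [h2]; gcongr
      exact (ENNReal.add_le_add_iff_left (measure_ne_top _ _)).1 h3
    have hcompl : ∀ (m : Measure 𝒲) [IsProbabilityMeasure m], m.real Cᶜ = 1 - m.real C :=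
      fun m _ => probReal_compl_eq_one_sub hCm
    have htsub : ∀ (m m' : Measure 𝒲) [IsProbabilityMeasure m] [IsProbabilityMeasure m']
        (E : Set 𝒲), m E - m' E ≤ ENNReal.ofReal (m.real E - m'.real E) := by
      intro m m' _ _ E
      rw [ENNReal.ofReal_sub _ measureReal_nonneg, ofReal_measureReal, ofReal_measureReal]
    have hreal : ∀ (m m' : Measure 𝒲) [IsProbabilityMeasure m] [IsProbabilityMeasure m']
        (E : Set 𝒲), m.restrict E ≤ m'.restrict E → m.real E ≤ m'.real E := by
      intro m m' _ _ E h
      have := h Set.univ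
      rw [Measure.restrict_apply_univ, Measure.restrict_apply_univ] at this
      exact ENNReal.toReal_mono (measure_ne_top _ _) this
    rintro (_ | _)
    · have hw := wasserstein_le_of_restrict_le hCm.compl hf2 (by rwa [compl_compl])
      have h0 := hreal _ _ _ hf1
      have e : ∫ w, f (x, w) * bitSign false ∂κ (x, false) - ∫ w, f (x, w) * bitSign false ∂N x
          = 2 * ((κ (x, false)).real Cᶜ - (N x).real Cᶜ) := by
        rw [integral_mul_const, integral_mul_const, hint, hint, hcompl, hcompl]
        simp [bitSign]; ring
      rw [e]
      refine ⟨?_, by rw [hcompl, hcompl]; linarith⟩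
      rw [ENNReal.ofReal_mul (by norm_num), ENNReal.ofReal_ofNat]
      gcongr
      exact hw.trans (htsub _ _ _)
    · have hw := wasserstein_le_of_restrict_le hCm ht1 ht2
      have h0 := hreal _ _ _ ht1
      have e : ∫ w, f (x, w) * bitSign true ∂κ (x, true) - ∫ w, f (x, w) * bitSign true ∂N x
          = 2 * ((κ (x, true)).real C - (N x).real C) := by
        rw [integral_mul_const, integral_mul_const, hint, hint]
        simp [bitSign]; ring
      rw [e]
      refine ⟨?_, by linarith⟩
      rw [ENNReal.ofReal_mul (by norm_num), ENNReal.ofReal_ofNat]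
      gcongr
      exact hw.trans (htsub _ _ _)
  have key' := ae_of_ae_map hX.aemeasurable key
  -- The Wasserstein integrand is not known to be measurable in ω; monotonicity of the lower
  -- integral and extraction of a finite constant do not require it.
  rw [integral_mul_bitSign_eq_integral_sub hX hY hW hXY hf hb, expectedWasserstein,
    ← lintegral_const_mul' _ _ (by simp), ofReal_integral_eq_lintegral_ofReal]
  · exact lintegral_mono_ae (key'.mono fun ω h => (h (Y ω)).1)
  · exact (integrable_integral_mul_bitSign hX hY hf hb _).sub
      (integrable_integral_mul_bitSign hX hY hf hb (N.comap Prod.fst measurable_fst))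
  · exact key'.mono fun ω h => (h (Y ω)).2

/-- A test function that changes sign with a uniform bit is controlled by the disintegrated
conditional mutual information. Here the test function may depend on more than the conditioning
variable `π ∘ X'`, as long as `W` depends on `X'` only through `π ∘ X'` and the bit. -/
theorem ofReal_integral_mul_bitSign_le_expectedSqrtCMI {X' : Ω → S'} (hX' : Measurable X')
    (hY : Measurable Y) (hW : Measurable W) {π : S' → S} (hπ : Measurable π)
    {Q : Kernel (S × Bool) 𝒲} [IsMarkovKernel Q]
    (h : P.map (fun ω => ((X' ω, Y ω), W ω)) =
      ((P.map X').prod coin) ⊗ₘ Q.comap (Prod.map π id) (hπ.prodMap measurable_id))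
    {f : S' × 𝒲 → ℝ} (hf : Measurable f) (hb : ∀ p, |f p| ≤ 1) :
    ENNReal.ofReal (∫ ω, f (X' ω, W ω) * bitSign (Y ω) ∂P)
      ≤ expectedSqrtCMI P W Y (fun ω => π (X' ω)) := by
  have hs := measurable_bitSign
  have hX : Measurable fun ω => π (X' ω) := hπ.comp hX'
  have hPX' : IsProbabilityMeasure (P.map X') := Measure.isProbabilityMeasure_map hX'.aemeasurable
  have hXmap : (P.map X').map π = P.map fun ω => π (X' ω) := Measure.map_map hπ hX'
  have hQ : P.map (fun ω => ((π (X' ω), Y ω), W ω)) =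
      ((P.map fun ω => π (X' ω)).prod coin) ⊗ₘ Q := by
    have := congrArg (Measure.map (Prod.map (Prod.map π id) id)) h
    rw [map_compProd_comap, ← Measure.map_prod_map _ _ hπ measurable_id, Measure.map_id, hXmap,
      Measure.map_map (by fun_prop) (by fun_prop)] at this
    exact this
  set K := Kernel.const S coin ⊗ₖ Q with hKdef
  have hK := map_prodMk_eq_compProd_const_compProd hX hY hW hQ
  have hV : Measurable fun ω => (Y ω, W ω) := by fun_prop
  have hKfst : ∀ x, (K x).map Prod.fst = coin := fun x => by
    rw [← Kernel.map_apply _ measurable_fst, ← Kernel.fst_eq, hKdef, Kernel.fst_compProd,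
      Kernel.const_apply]
  -- The null set depends on x only, and the bound holds on the whole fibre over x: the conditional
  -- law of (Y, W) is the same along the fibre, so x' is a frozen parameter of the test function.
  have hpt : ∀ᵐ x ∂(P.map fun ω => π (X' ω)), ∀ x', π x' = x →
      ENNReal.ofReal (∫ y, ∫ w, f (x', w) * bitSign y ∂(Q (x, y)) ∂coin)
        ≤ (2 * disintegratedCMI P W Y (fun ω => π (X' ω)) x) ^ (1 / 2 : ℝ) := by
    filter_upwards [condDistrib_comp_ae_eq hV hK measurable_fst,
      condDistrib_comp_ae_eq hV hK measurable_snd,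
      condDistrib_comp_ae_eq hV hK measurable_swap] with x h1 h2 h3 x' hx'
    have hg : Measurable fun p : 𝒲 × Bool => f (x', p.1) * bitSign p.2 := by fun_prop
    have hgb : ∀ p : 𝒲 × Bool, |f (x', p.1) * bitSign p.2| ≤ 1 := fun p =>
      abs_mul_bitSign_le_one (hb _) _
    have hp1 : IsProbabilityMeasure ((K x).map Prod.swap) :=
      Measure.isProbabilityMeasure_map measurable_swap.aemeasurable
    have hp2 : IsProbabilityMeasure ((K x).map Prod.snd) :=
      Measure.isProbabilityMeasure_map measurable_snd.aemeasurable
    have hP := ofReal_integral_sub_integral_le_sqrt_klDiv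
      (μ := (K x).map Prod.swap) (ν := ((K x).map Prod.snd).prod coin) hg hgb
    have e1 : disintegratedCMI P W Y (fun ω => π (X' ω)) x
        = klDiv ((K x).map Prod.swap) (((K x).map Prod.snd).prod coin) := by
      rw [disintegratedCMI, h2, h1, hKfst]
      congr 1
    have e2 : ∫ p, f (x', p.1) * bitSign p.2 ∂(((K x).map Prod.snd).prod coin) = 0 := by
      rw [integral_prod_mul (fun w => f (x', w)) bitSign, integral_bitSign_coin, mul_zero]
    have e3 : ∫ p, f (x', p.1) * bitSign p.2 ∂((K x).map Prod.swap)
        = ∫ y, ∫ w, f (x', w) * bitSign y ∂(Q (x, y)) ∂coin := by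
      rw [integral_map measurable_swap.aemeasurable hg.aestronglyMeasurable, hKdef,
        integral_compProd]
      · rfl
      · exact integrable_of_abs_le_one (hg.comp measurable_swap) fun p => hgb _
    rw [e1, ← e3, ← sub_zero (∫ p, _ ∂((K x).map Prod.swap)), ← e2]
    exact hP
  have hfm : Measurable fun p : (S' × Bool) × 𝒲 => f (p.1.1, p.2) * bitSign p.1.2 := by fun_prop
  have hfb : ∀ p : (S' × Bool) × 𝒲, |f (p.1.1, p.2) * bitSign p.1.2| ≤ 1 := fun p =>
    abs_mul_bitSign_le_one (hb _) _
  have m1 := measurable_integral_kernel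
    (κ := Q.comap (Prod.map π id) (hπ.prodMap measurable_id)) hfm
  have e : ∫ ω, f (X' ω, W ω) * bitSign (Y ω) ∂P =
      ∫ ω, ∫ y, ∫ w, f (X' ω, w) * bitSign y ∂(Q (π (X' ω), y)) ∂coin ∂P := by
    rw [← integral_map (φ := fun ω => ((X' ω, Y ω), W ω))
      (f := fun p : (S' × Bool) × 𝒲 => f (p.1.1, p.2) * bitSign p.1.2) (by fun_prop)
      hfm.aestronglyMeasurable, h, Measure.integral_compProd (integrable_of_abs_le_one hfm hfb),
      integral_prod _ (integrable_of_abs_le_one m1 fun q => abs_integral_le_one fun w => hfb (q, w)),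
      integral_map hX'.aemeasurable]
    · rfl
    · exact (m1.stronglyMeasurable.integral_prod_right' (ν := coin)).aestronglyMeasurable
  rw [e, expectedSqrtCMI]
  refine ofReal_integral_le_lintegral_ofReal.trans (lintegral_mono_ae ?_)
  filter_upwards [ae_of_ae_map hX.aemeasurable hpt] with ω hω
  exact hω _ rfl

end CondDistrib

end UniformBit

/-! ### Product measures -/

section Pi

variable {ι : Type*} [Fintype ι]

/-- Resampling one coordinate independently preserves a product law. This isolates coordinate i from
the others without splitting the index set. -/
lemma measurePreserving_update [DecidableEq ι] {X : ι → Type*} [∀ i, MeasurableSpace (X i)]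
    (μ : ∀ i, Measure (X i)) [∀ i, IsProbabilityMeasure (μ i)] (i : ι) :
    MeasurePreserving (fun p : (∀ i, X i) × X i => Function.update p.1 i p.2)
      ((Measure.pi μ).prod (μ i)) (Measure.pi μ) := by
  have hm : Measurable fun p : (∀ i, X i) × X i => Function.update p.1 i p.2 :=
    measurable_update'
  refine ⟨hm, (Measure.pi_eq fun s hs => ?_).symm⟩
  rw [Measure.map_apply hm (.univ_pi hs)]
  have : (fun p : (∀ i, X i) × X i => Function.update p.1 i p.2) ⁻¹' Set.univ.pi s =
      (Set.univ.pi (Function.update s i Set.univ)) ×ˢ s i := by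
    ext p
    simp only [Set.mem_preimage, Set.mem_pi, Set.mem_univ, true_imp_iff, Set.mem_prod]
    constructor
    · intro h
      refine ⟨fun j => ?_, by simpa using h i⟩
      by_cases hj : j = i
      · subst hj; simp
      · simpa [hj] using h j
    · rintro ⟨h1, h2⟩ j
      by_cases hj : j = i
      · subst hj; simpa using h2
      · simpa [hj] using h1 j
  rw [this, Measure.prod_prod, Measure.pi_pi,
    ← Finset.mul_prod_erase Finset.univ (fun j => μ j (s j)) (Finset.mem_univ i),
    ← Finset.mul_prod_erase Finset.univ _ (Finset.mem_univ i)]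
  simp only [Function.update_self, measure_univ, one_mul]
  rw [mul_comm]
  congr 1
  exact Finset.prod_congr rfl fun j hj => by rw [Function.update_of_ne (Finset.ne_of_mem_erase hj)]

lemma lintegral_pi_update [DecidableEq ι] {X : ι → Type*} [∀ i, MeasurableSpace (X i)]
    (μ : ∀ i, Measure (X i)) [∀ i, IsProbabilityMeasure (μ i)] (i : ι) {F : (∀ i, X i) → ℝ≥0∞}
    (hF : Measurable F) :
    ∫⁻ x, F x ∂(Measure.pi μ) = ∫⁻ x, ∫⁻ y, F (Function.update x i y) ∂(μ i) ∂(Measure.pi μ) := by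
  have h := measurePreserving_update μ i
  rw [← h.lintegral_comp hF]
  exact lintegral_prod _ (hF.comp h.measurable).aemeasurable

lemma pi_map_comp_injective {κ X : Type*} [Fintype κ] [MeasurableSpace X] (m : Measure X)
    [IsProbabilityMeasure m] {e : κ → ι} (he : e.Injective) :
    (Measure.pi fun _ : ι => m).map (fun z k => z (e k)) = Measure.pi fun _ : κ => m := by
  have h := iIndepFun_pi (μ := fun _ : ι => m) (X := fun _ => id) fun _ => aemeasurable_id
  have h' := (h.precomp he).map_fun_eq_pi_map fun k => (measurable_pi_apply _).aemeasurable
  refine h'.trans ?_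
  congr 1
  ext1 k
  exact (measurePreserving_eval (fun _ : ι => m) (e k)).map_eq

/-- Blocks are independent, so extra information from block i depends, given all the selections,
only on the selection in block i. Resampling coordinate i reduces this to the one-block identity
`h`. -/
lemma pi_map_prodMk_eval {X T E : Type*} [MeasurableSpace X] [MeasurableSpace T]
    [MeasurableSpace E] (ν : Measure X) [IsProbabilityMeasure ν] (τ : Measure T)
    [IsProbabilityMeasure τ] (sel : ι → X → T)
    (hsel : ∀ i, Measurable (sel i)) (hτ : ∀ i, ν.map (sel i) = τ) (i : ι) {gh : X → E}
    (hgh : Measurable gh) (κ : Kernel T E) [IsMarkovKernel κ]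
    (h : ν.map (fun y => (sel i y, gh y)) = τ ⊗ₘ κ) :
    (Measure.pi fun _ : ι => ν).map (fun x => (fun j => sel j (x j), gh (x i))) =
      (Measure.pi fun _ : ι => τ) ⊗ₘ κ.comap (fun t => t i) (measurable_pi_apply i) := by
  classical
  have hselm : Measurable fun (x : ι → X) j => sel j (x j) := by fun_prop
  have hmap : (Measure.pi fun _ : ι => ν).map (fun x j => sel j (x j)) =
      Measure.pi fun _ : ι => τ := by
    rw [Measure.pi_map_pi fun i => (hsel i).aemeasurable]
    simp_rw [hτ]
  refine Measure.ext_of_lintegral _ fun g hg => ?_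
  have hup' : Measurable fun p : (ι → T) × T => Function.update p.1 i p.2 := measurable_update'
  set κ' := κ.comap (fun t : ι → T => t i) (measurable_pi_apply i) with hκ'
  have hκm : Measurable fun t : ι → T => ∫⁻ e, g (t, e) ∂(κ' t) :=
    Measurable.lintegral_kernel_prod_right' hg
  have hG : Measurable fun x : ι → X => g (fun j => sel j (x j), gh (x i)) := by fun_prop
  rw [lintegral_map hg (by fun_prop), Measure.lintegral_compProd hg,
    lintegral_pi_update (fun _ : ι => ν) i hG, lintegral_pi_update (fun _ : ι => τ) i hκm,
    ← hmap]
  refine Eq.trans ?_ (lintegral_map (hκm.comp hup').lintegral_prod_right' hselm).symm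
  refine lintegral_congr fun x => ?_
  have hgx : Measurable fun p : T × E =>
      g (Function.update (fun j => sel j (x j)) i p.1, p.2) :=
    hg.comp (((measurable_update _).comp measurable_fst).prodMk measurable_snd)
  have e := congrArg (fun m => ∫⁻ p, g (Function.update (fun j => sel j (x j)) i p.1, p.2) ∂m) h
  rw [lintegral_map hgx (by fun_prop), Measure.lintegral_compProd hgx] at e
  have hL : ∀ y, g (fun j => sel j (Function.update x i y j), gh (Function.update x i y i)) =
      g (Function.update (fun j => sel j (x j)) i (sel i y), gh y) := fun y => by
    rw [Function.update_self]
    congr 2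
    ext1 j
    by_cases hj : j = i
    · subst hj; simp
    · simp [hj]
  refine (lintegral_congr hL).trans (e.trans ?_)
  simp only [hκ', Kernel.comap_apply, Function.update_self, Function.comp_apply]

end Pi

/-- A law that is the same for each frozen value of an independent variable is also the
unconditional law. It is used to freeze all the selection bits. -/
lemma prod_map_eq_of_forall {A B E : Type*} [MeasurableSpace A] [MeasurableSpace B]
    [MeasurableSpace E] {μ : Measure A} [SFinite μ] {ν : Measure B} [IsProbabilityMeasure ν]
    {F : A × B → E} (hF : Measurable F) {ρ : Measure E}
    (h : ∀ b, μ.map (fun a => F (a, b)) = ρ) : (μ.prod ν).map F = ρ := by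
  ext s hs
  rw [Measure.map_apply hF hs, Measure.prod_apply_symm (hF hs)]
  have : ∀ b, μ ((fun a => (a, b)) ⁻¹' (F ⁻¹' s)) = ρ s := fun b => by
    rw [← h b, Measure.map_apply (by fun_prop) hs]; rfl
  simp [this]

lemma measurable_bool_apply {A C : Type*} [MeasurableSpace A] [MeasurableSpace C]
    {f : Bool → A → C} {b : A → Bool} (hf : ∀ c, Measurable (f c)) (hb : Measurable b) :
    Measurable fun a => f (b a) a :=
  (measurable_from_prod_countable_right (f := fun p : Bool × A => f p.1 p.2) hf).comp
    (hb.prodMk measurable_id)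

/-! ### Sampling from a client -/

section Client

variable {Z : Type*} [MeasurableSpace Z]

/-- Sampling of one data point from a client. -/
noncomputable def clientKernel : Kernel (ProbabilityMeasure Z) Z where
  toFun m := m
  measurable' := measurable_subtype_coe

lemma clientKernel_apply (m : ProbabilityMeasure Z) : clientKernel m = (m : Measure Z) := rfl

instance : IsMarkovKernel (clientKernel (Z := Z)) := ⟨fun m => by
  rw [clientKernel_apply]; infer_instance⟩

lemma iidKernel_apply (ι : Type*) [Fintype ι] (m : ProbabilityMeasure Z) :
    iidKernel ι m = Measure.pi fun _ : ι => (m : Measure Z) := rfl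

lemma compProd_iidKernel_map_comp (D : Measure (ProbabilityMeasure Z)) [SFinite D]
    {ι κ : Type*} [Fintype ι] [Fintype κ] {e : κ → ι} (he : e.Injective) :
    (D ⊗ₘ iidKernel ι).map (fun y => (y.1, fun k => y.2 (e k))) = D ⊗ₘ iidKernel κ := by
  have hm : Measurable fun (z : ι → Z) k => z (e k) := by fun_prop
  have h : (iidKernel ι).map (fun (z : ι → Z) k => z (e k)) = iidKernel κ := by
    ext1 m
    rw [Kernel.map_apply _ hm, iidKernel_apply, iidKernel_apply, pi_map_comp_injective _ he]
  rw [← h, Measure.compProd_map hm]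
  rfl

/-- The index `none` is one additional sample: given the client and the other samples, it is again a
draw from that client. -/
lemma compProd_iidKernel_option (D : Measure (ProbabilityMeasure Z)) [SFinite D]
    {κ : Type*} [Fintype κ] :
    (D ⊗ₘ iidKernel (Option κ)).map (fun y => ((y.1, fun k => y.2 (some k)), y.2 none)) =
      (D ⊗ₘ iidKernel κ) ⊗ₘ clientKernel.comap Prod.fst measurable_fst := by
  refine Measure.ext_of_lintegral _ fun g hg => ?_
  rw [lintegral_map hg (by fun_prop), Measure.lintegral_compProd (by fun_prop),
    Measure.lintegral_compProd hg,
    Measure.lintegral_compProd (Measurable.lintegral_kernel_prod_right' hg)]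
  refine lintegral_congr fun m => ?_
  have hgm : Measurable fun p : (κ → Z) × Z => g ((m, p.1), p.2) := by fun_prop
  simp only [iidKernel_apply, Kernel.comap_apply, clientKernel_apply]
  rw [← Measure.pi_map_piOptionEquivProd (fun _ : Option κ => (m : Measure Z)), lintegral_map]
  · exact lintegral_prod _ hgm.aemeasurable
  · fun_prop
  · exact MeasurableEquiv.measurable _

/-- The client with the `n` data points that the bits `u` select from its `n` pairs. -/
def selectData {n : ℕ} (u : Fin n → Bool) (y : ProbabilityMeasure Z × (Fin n × Bool → Z)) :
    ProbabilityMeasure Z × (Fin n → Z) :=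
  (y.1, fun j => y.2 (j, u j))

lemma measurable_selectData {n : ℕ} (u : Fin n → Bool) : Measurable (selectData (Z := Z) u) := by
  unfold selectData; fun_prop

lemma map_selectData (D : Measure (ProbabilityMeasure Z)) [SFinite D] {n : ℕ} (u : Fin n → Bool) :
    (D ⊗ₘ iidKernel (Fin n × Bool)).map (selectData u) = D ⊗ₘ iidKernel (Fin n) :=
  compProd_iidKernel_map_comp D (e := fun j => (j, u j)) fun _ _ h => (Prod.mk.inj h).1

lemma map_selectData_unselected (D : Measure (ProbabilityMeasure Z)) [SFinite D] {n : ℕ}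
    (u : Fin n → Bool) (j : Fin n) :
    (D ⊗ₘ iidKernel (Fin n × Bool)).map (fun y => (selectData u y, y.2 (j, !u j))) =
      (D ⊗ₘ iidKernel (Fin n)) ⊗ₘ clientKernel.comap Prod.fst measurable_fst := by
  -- The selected indices and the one unselected index are n + 1 distinct positions of the
  -- supersample.
  let e : Option (Fin n) → Fin n × Bool := fun o => o.elim (j, !u j) fun k => (k, u k)
  have he : e.Injective := by
    rintro (_ | k) (_ | l) h
    · rfl
    · simp only [e, Option.elim, Prod.mk.injEq] at h
      obtain ⟨rfl, h⟩ := h; simp at h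
    · simp only [e, Option.elim, Prod.mk.injEq] at h
      obtain ⟨rfl, h⟩ := h; simp at h
    · simp only [e, Option.elim, Prod.mk.injEq] at h
      rw [h.1]
  rw [← compProd_iidKernel_option, ← compProd_iidKernel_map_comp D he,
    Measure.map_map (by fun_prop) (by fun_prop)]
  rfl

lemma map_unselected (D : Measure (ProbabilityMeasure Z)) [SFinite D] {κ : Type*} [Fintype κ]
    (k : κ) : (D ⊗ₘ iidKernel κ).map (fun y => (y.1, y.2 k)) = D ⊗ₘ clientKernel := by
  have h : (iidKernel κ).map (fun z : κ → Z => z k) = clientKernel := by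
    ext1 m
    rw [Kernel.map_apply _ (by fun_prop), iidKernel_apply]
    exact (measurePreserving_eval (fun _ : κ => (m : Measure Z)) k).map_eq
  rw [← h, Measure.compProd_map (by fun_prop)]
  rfl

end Client

lemma pi_bool_map_eval {X C : Type*} [MeasurableSpace X] [MeasurableSpace C] (η : Measure X)
    [IsProbabilityMeasure η] (v : Bool) {f : X → C} (hf : Measurable f) :
    (Measure.pi fun _ : Bool => η).map (fun y => f (y v)) = η.map f := by
  conv_rhs => rw [← (measurePreserving_eval (fun _ : Bool => η) v).map_eq]
  rw [Measure.map_map hf (by fun_prop)]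
  rfl

lemma pi_bool_map_prodMk {X : Type*} [MeasurableSpace X] (η : Measure X) [IsProbabilityMeasure η]
    (v : Bool) : (Measure.pi fun _ : Bool => η).map (fun y => (y v, y !v)) = η.prod η := by
  refine (Measure.prod_eq fun s t hs ht => ?_).symm
  rw [Measure.map_apply (by fun_prop) (hs.prod ht)]
  have : (fun y : Bool → X => (y v, y !v)) ⁻¹' s ×ˢ t =
      Set.univ.pi fun b => if b = v then s else t := by
    ext y
    cases v <;> simp [and_comm]
  rw [this, Measure.pi_pi]
  cases v <;> simp [mul_comm]

section Model

variable {Z 𝒲 : Type*} [MeasurableSpace Z] [MeasurableSpace 𝒲] {K n : ℕ}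
  (D : Measure (ProbabilityMeasure Z)) [IsProbabilityMeasure D]

/-! ### Ghost samples -/

/-- The client `μ^{i,b}` with the one of its `j`-th pair of data points that its own bit does not
select. -/
def ghostPoint (i : Fin K) (j : Fin n) (b : Bool) (s : Super K n Z) : ProbabilityMeasure Z × Z :=
  ((s.1 i b).1, (s.1 i b).2 (j, !s.2.2 i b j))

lemma measurable_ghostPoint (i : Fin K) (j : Fin n) (b : Bool) :
    Measurable (ghostPoint (Z := Z) i j b) := by
  refine Measurable.prodMk (by fun_prop) ?_
  exact measurable_bool_apply (f := fun c (s : Super K n Z) => (s.1 i b).2 (j, c))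
    (b := fun s : Super K n Z => !s.2.2 i b j) (fun c => by fun_prop)
    ((measurable_of_finite not).comp (by fun_prop : Measurable fun s : Super K n Z => s.2.2 i b j))

lemma measurable_ghostPoint_bit (i : Fin K) (j : Fin n) (g : Bool → Bool) :
    Measurable fun s : Super K n Z => ghostPoint i j (g (s.2.1 i)) s :=
  measurable_bool_apply (b := fun s : Super K n Z => g (s.2.1 i)) (measurable_ghostPoint i j)
    ((measurable_of_finite g).comp (by fun_prop : Measurable fun s : Super K n Z => s.2.1 i))

instance : IsProbabilityMeasure (treeLaw K n D) := by unfold treeLaw; infer_instance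

/-- Given the training tree, the unselected data points of the participating clients are fresh
samples of these clients. -/
lemma map_selectedTree_ghostPoint (i : Fin K) (j : Fin n) :
    (superLaw K n D).map (fun s => (selectedTree s, (ghostPoint i j (s.2.1 i) s).2)) =
      treeLaw K n D ⊗ₘ clientKernel.comap (fun t => (t i).1) (by fun_prop) := by
  -- With the bits frozen, selection is a fixed map in each block.
  refine prod_map_eq_of_forall ((measurable_selectedTree K n).prodMk
    (measurable_snd.comp (measurable_ghostPoint_bit i j id))) fun b => ?_
  refine pi_map_prodMk_eval (ι := Fin K)
    (Measure.pi fun _ : Bool => D ⊗ₘ iidKernel (Z := Z) (Fin n × Bool)) (D ⊗ₘ iidKernel (Fin n))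
    (fun i' y => selectData (b.2 i' (b.1 i')) (y (b.1 i')))
    (fun i' => (measurable_selectData _).comp (measurable_pi_apply _)) (fun i' => ?_) i
    (gh := fun y => (y (b.1 i)).2 (j, !b.2 i (b.1 i) j)) (by fun_prop)
    (clientKernel.comap Prod.fst measurable_fst) ?_
  · exact (pi_bool_map_eval _ _ (measurable_selectData _)).trans (map_selectData D _)
  · exact (pi_bool_map_eval _ _ ((measurable_selectData _).prodMk (by fun_prop))).trans
      (map_selectData_unselected D _ j)

/-- The clients that do not participate are independent of the training tree. -/
lemma map_selectedTree_ghostPoint_not (i : Fin K) (j : Fin n) :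
    (superLaw K n D).map (fun s => (selectedTree s, ghostPoint i j (!s.2.1 i) s)) =
      treeLaw K n D ⊗ₘ Kernel.const _ (D ⊗ₘ clientKernel) := by
  refine prod_map_eq_of_forall ((measurable_selectedTree K n).prodMk
    (measurable_ghostPoint_bit i j not)) fun b => ?_
  refine pi_map_prodMk_eval (ι := Fin K)
    (Measure.pi fun _ : Bool => D ⊗ₘ iidKernel (Z := Z) (Fin n × Bool)) (D ⊗ₘ iidKernel (Fin n))
    (fun i' y => selectData (b.2 i' (b.1 i')) (y (b.1 i')))
    (fun i' => (measurable_selectData _).comp (measurable_pi_apply _)) (fun i' => ?_) i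
    (gh := fun y => ((y (!b.1 i)).1, (y (!b.1 i)).2 (j, !b.2 i (!b.1 i) j))) (by fun_prop)
    (Kernel.const _ (D ⊗ₘ clientKernel)) ?_
  · exact (pi_bool_map_eval _ _ (measurable_selectData _)).trans (map_selectData D _)
  · rw [Measure.compProd_const, ← map_selectData D (b.2 i (b.1 i)),
      ← map_unselected D (j, !b.2 i (!b.1 i) j),
      Measure.map_prod_map _ _ (measurable_selectData _) (by fun_prop),
      ← pi_bool_map_prodMk _ (b.1 i),
      Measure.map_map ((measurable_selectData _).prodMap (by fun_prop)) (by fun_prop)]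
    rfl

lemma map_selectedTree (hn : 0 < n) (i : Fin K) :
    (superLaw K n D).map selectedTree = treeLaw K n D := by
  rw [← Measure.fst_compProd (treeLaw K n D) (Kernel.const _ (D ⊗ₘ clientKernel)),
    ← map_selectedTree_ghostPoint_not D i ⟨0, hn⟩,
    Measure.fst_map_prodMk (measurable_ghostPoint_bit i ⟨0, hn⟩ not)]

/-! ### The joint law with the hypothesis -/

variable (A : Kernel (Tree K n Z) 𝒲) [IsMarkovKernel A]

lemma jointLaw_map_fst : (jointLaw D A).map Prod.fst = superLaw K n D :=
  Measure.fst_compProd _ _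

lemma jointLaw_map_comp_fst {S : Type*} [MeasurableSpace S] {φ : Super K n Z → S}
    (hφ : Measurable φ) : (jointLaw D A).map (fun ω => φ ω.1) = (superLaw K n D).map φ := by
  rw [← jointLaw_map_fst D A, Measure.map_map hφ measurable_fst]
  rfl

/-- Ghost variables that only depend on the training tree are independent of the hypothesis given
the tree. -/
lemma jointLaw_map_ghost {E : Type*} [MeasurableSpace E] {e : Super K n Z → E} (he : Measurable e)
    (κ : Kernel (Tree K n Z) E) [IsMarkovKernel κ]
    (h : (superLaw K n D).map (fun s => (selectedTree s, e s)) = treeLaw K n D ⊗ₘ κ) :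
    (jointLaw D A).map (fun ω => ((selectedTree ω.1, ω.2), e ω.1)) =
      (treeLaw K n D ⊗ₘ A) ⊗ₘ κ.comap Prod.fst measurable_fst := by
  have hT := measurable_selectedTree K n (Z := Z)
  refine Measure.ext_of_lintegral _ fun g hg => ?_
  rw [lintegral_map hg (by fun_prop), jointLaw, Measure.lintegral_compProd (by fun_prop),
    Measure.lintegral_compProd hg,
    Measure.lintegral_compProd (Measurable.lintegral_kernel_prod_right' hg)]
  have hF : Measurable fun q : (Tree K n Z × E) × 𝒲 => g ((q.1.1, q.2), q.1.2) := by fun_prop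
  have hF' : Measurable fun q : Tree K n Z × E => ∫⁻ w, g ((q.1, w), q.2) ∂(A q.1) :=
    Measurable.lintegral_kernel_prod_right' (κ := A.comap Prod.fst measurable_fst) hF
  have e1 := lintegral_map (μ := superLaw K n D) hF' (hT.prodMk he)
  rw [h, Measure.lintegral_compProd hF'] at e1
  -- Given the tree t, the hypothesis and the ghost are drawn independently, so the two integrations
  -- commute.
  refine e1.symm.trans (lintegral_congr fun t => ?_)
  refine lintegral_lintegral_swap (μ := A t) (ν := κ t) (f := fun w e => g ((t, w), e))
    (Measurable.aemeasurable ?_) |>.symm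
  exact hg.comp ((measurable_const.prodMk measurable_fst).prodMk measurable_snd)

end Model

/-! ### Two-sided bounds for sign-changing test functions -/

lemma ofReal_abs_le {a : ℝ} {C : ℝ≥0∞} (h1 : ENNReal.ofReal a ≤ C) (h2 : ENNReal.ofReal (-a) ≤ C) :
    ENNReal.ofReal |a| ≤ C := by
  rcases abs_choice a with h | h <;> rwa [h]

section UniformBit

variable {Ω 𝒲 S : Type*} [MeasurableSpace Ω] [MeasurableSpace 𝒲] [MeasurableSpace S]
  {P : Measure Ω} [IsProbabilityMeasure P] [StandardBorelSpace 𝒲] [Nonempty 𝒲]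
  {W : Ω → 𝒲} {Y : Ω → Bool} {X : Ω → S}

lemma ofReal_abs_integral_mul_bitSign_le_expectedWasserstein (hX : Measurable X)
    (hY : Measurable Y) (hW : Measurable W)
    (hXY : P.map (fun ω => (X ω, Y ω)) = (P.map X).prod coin)
    {f : S × 𝒲 → ℝ} (hf : Measurable f) (hb : ∀ p, |f p| ≤ 1) :
    ENNReal.ofReal |∫ ω, f (X ω, W ω) * bitSign (Y ω) ∂P| ≤ 2 * expectedWasserstein P W Y X := by
  refine ofReal_abs_le
    (ofReal_integral_mul_bitSign_le_expectedWasserstein hX hY hW hXY hf hb) ?_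
  have := ofReal_integral_mul_bitSign_le_expectedWasserstein hX hY hW hXY hf.neg
    fun p => by simpa using hb p
  simpa [neg_mul, integral_neg] using this

lemma ofReal_integral_mul_bitSign_le_expectedSqrtCMI_self (hX : Measurable X)
    (hY : Measurable Y) (hW : Measurable W)
    (hXY : P.map (fun ω => (X ω, Y ω)) = (P.map X).prod coin)
    {f : S × 𝒲 → ℝ} (hf : Measurable f) (hb : ∀ p, |f p| ≤ 1) :
    ENNReal.ofReal (∫ ω, f (X ω, W ω) * bitSign (Y ω) ∂P) ≤ expectedSqrtCMI P W Y X := by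
  refine ofReal_integral_mul_bitSign_le_expectedSqrtCMI hX hY hW measurable_id
    (Q := condDistrib W (fun ω' => (X ω', Y ω')) P) ?_ hf hb
  rw [← hXY, ← compProd_map_condDistrib hW.aemeasurable]
  congr 1

lemma ofReal_abs_integral_mul_bitSign_le_expectedSqrtCMI (hX : Measurable X)
    (hY : Measurable Y) (hW : Measurable W)
    (hXY : P.map (fun ω => (X ω, Y ω)) = (P.map X).prod coin)
    {f : S × 𝒲 → ℝ} (hf : Measurable f) (hb : ∀ p, |f p| ≤ 1) :
    ENNReal.ofReal |∫ ω, f (X ω, W ω) * bitSign (Y ω) ∂P| ≤ expectedSqrtCMI P W Y X := by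
  refine ofReal_abs_le
    (ofReal_integral_mul_bitSign_le_expectedSqrtCMI_self hX hY hW hXY hf hb) ?_
  have := ofReal_integral_mul_bitSign_le_expectedSqrtCMI_self hX hY hW hXY hf.neg
    fun p => by simpa using hb p
  simpa [neg_mul, integral_neg] using this

end UniformBit

lemma map_prodMk_coin_of_measurePreserving {Ω R S : Type*} [MeasurableSpace Ω] [MeasurableSpace R]
    [MeasurableSpace S] {P : Measure Ω} {X' : Ω → R} {Y : Ω → Bool} {ρ : Measure R} [SFinite ρ]
    (h : MeasurePreserving (fun ω => (X' ω, Y ω)) P (ρ.prod coin)) {φ : R → S}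
    (hφ : Measurable φ) :
    P.map (fun ω => (φ (X' ω), Y ω)) = (P.map fun ω => φ (X' ω)).prod coin := by
  have hX' : Measurable X' := measurable_fst.comp h.measurable
  have h1 : P.map X' = ρ := by
    have := congrArg (Measure.map Prod.fst) h.map_eq
    rw [Measure.map_map measurable_fst h.measurable, Measure.map_fst_prod] at this
    rwa [measure_univ, one_smul] at this
  rw [← Function.comp_def φ X', ← Measure.map_map hφ hX', h1]
  conv_rhs => rw [← Measure.map_id (μ := coin)]
  rw [Measure.map_prod_map _ _ hφ measurable_id, ← h.map_eq,
    Measure.map_map (hφ.prodMap measurable_id) h.measurable]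
  rfl

lemma abs_sub_le_one {a b : ℝ} (ha : a ∈ Set.Icc (0 : ℝ) 1) (hb : b ∈ Set.Icc (0 : ℝ) 1) :
    |a - b| ≤ 1 := abs_le.2 ⟨by linarith [ha.1, hb.2], by linarith [ha.2, hb.1]⟩

lemma abs_le_one_of_mem_Icc {a : ℝ} (ha : a ∈ Set.Icc (0 : ℝ) 1) : |a| ≤ 1 :=
  abs_le.2 ⟨by linarith [ha.1], ha.2⟩

lemma integral_mem_Icc {B : Type*} [MeasurableSpace B] {μ : Measure B} [IsProbabilityMeasure μ]
    {g : B → ℝ} (hb : ∀ b, g b ∈ Set.Icc (0 : ℝ) 1) : ∫ b, g b ∂μ ∈ Set.Icc (0 : ℝ) 1 :=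
  ⟨integral_nonneg fun b => (hb b).1,
    (le_abs_self _).trans (abs_integral_le_one fun b => abs_le_one_of_mem_Icc (hb b))⟩

/-! ### Risk of a single client -/

section Risk

variable {Z 𝒲 : Type*} [MeasurableSpace Z] {loss : 𝒲 → Z → ℝ}

/-- The risk of a hypothesis for one client. -/
noncomputable def clientRisk (loss : 𝒲 → Z → ℝ) (w : 𝒲) (m : ProbabilityMeasure Z) : ℝ :=
  ∫ z, loss w z ∂(m : Measure Z)

lemma clientRisk_mem_Icc (hbdd : ∀ w z, loss w z ∈ Set.Icc (0 : ℝ) 1) (w : 𝒲)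
    (m : ProbabilityMeasure Z) : clientRisk loss w m ∈ Set.Icc (0 : ℝ) 1 :=
  integral_mem_Icc (hbdd w)

lemma popRisk_eq_integral_clientRisk (D : Measure (ProbabilityMeasure Z)) (loss : 𝒲 → Z → ℝ)
    (w : 𝒲) : popRisk D loss w = ∫ m, clientRisk loss w m ∂D := rfl

end Risk

section Model

variable {Z 𝒲 : Type*} [MeasurableSpace Z] [MeasurableSpace 𝒲] {K n : ℕ}
  (D : Measure (ProbabilityMeasure Z)) [IsProbabilityMeasure D]
  (A : Kernel (Tree K n Z) 𝒲) [IsMarkovKernel A]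

/-! ### The bits are independent of the supersample -/

lemma measurable_selectedBit_super (i : Fin K) (j : Fin n) :
    Measurable fun s : Super K n Z => s.2.2 i (s.2.1 i) j :=
  measurable_bool_apply (f := fun b (s : Super K n Z) => s.2.2 i b j)
    (b := fun s : Super K n Z => s.2.1 i) (fun b => by fun_prop) (by fun_prop)

/-- V_i is one coordinate of a product factor separate from the supersample and the bits U; the
composed maps only rearrange the factors. -/
lemma jointLaw_map_bitV (i : Fin K) {S : Type*} [MeasurableSpace S]
    {φ : (Fin K → Bool → ProbabilityMeasure Z × (Fin n × Bool → Z)) ×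
      (Fin K → Bool → Fin n → Bool) → S} (hφ : Measurable φ) :
    (jointLaw D A).map (fun ω => (φ (ω.1.1, ω.1.2.2), bitV i ω)) =
      ((jointLaw D A).map fun ω => φ (ω.1.1, ω.1.2.2)).prod coin := by
  have h1 : MeasurePreserving (Prod.fst : Super K n Z × 𝒲 → _) (jointLaw D A) (superLaw K n D) :=
    ⟨measurable_fst, jointLaw_map_fst D A⟩
  have h2 := (MeasurePreserving.id (Measure.pi fun _ : Fin K => Measure.pi fun _ : Bool =>
    D ⊗ₘ iidKernel (Z := Z) (Fin n × Bool))).prod (Measure.measurePreserving_swap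
      (μ := Measure.pi fun _ : Fin K => coin)
      (ν := Measure.pi fun _ : Fin K => Measure.pi fun _ : Bool => Measure.pi fun _ : Fin n => coin))
  have h3 := (measurePreserving_prodAssoc (Measure.pi fun _ : Fin K => Measure.pi fun _ : Bool =>
    D ⊗ₘ iidKernel (Z := Z) (Fin n × Bool)) (Measure.pi fun _ : Fin K => Measure.pi fun _ : Bool =>
      Measure.pi fun _ : Fin n => coin) (Measure.pi fun _ : Fin K => coin)).symm
  have h4 := (MeasurePreserving.id ((Measure.pi fun _ : Fin K => Measure.pi fun _ : Bool =>
    D ⊗ₘ iidKernel (Z := Z) (Fin n × Bool)).prod (Measure.pi fun _ : Fin K => Measure.pi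
      fun _ : Bool => Measure.pi fun _ : Fin n => coin))).prod
      (measurePreserving_eval (fun _ : Fin K => coin) i)
  exact map_prodMk_coin_of_measurePreserving (h4.comp (h3.comp (h2.comp h1))) hφ

/-- The position of the selected bit depends on V_i, but for each frozen value of V the bit read
there is uniform. A skew product over (supersample, V) expresses this. -/
lemma jointLaw_map_selectedBit (i : Fin K) (j : Fin n) {S : Type*} [MeasurableSpace S]
    {φ : (Fin K → Bool → ProbabilityMeasure Z × (Fin n × Bool → Z)) × (Fin K → Bool) → S}
    (hφ : Measurable φ) :
    (jointLaw D A).map (fun ω => (φ (ω.1.1, ω.1.2.1), selectedBit i j ω)) =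
      ((jointLaw D A).map fun ω => φ (ω.1.1, ω.1.2.1)).prod coin := by
  have h1 : MeasurePreserving (Prod.fst : Super K n Z × 𝒲 → _) (jointLaw D A) (superLaw K n D) :=
    ⟨measurable_fst, jointLaw_map_fst D A⟩
  have h3 := (measurePreserving_prodAssoc (Measure.pi fun _ : Fin K => Measure.pi fun _ : Bool =>
    D ⊗ₘ iidKernel (Z := Z) (Fin n × Bool)) (Measure.pi fun _ : Fin K => coin)
    (Measure.pi fun _ : Fin K => Measure.pi fun _ : Bool => Measure.pi fun _ : Fin n => coin)).symm
  have h4 := (MeasurePreserving.id ((Measure.pi fun _ : Fin K => Measure.pi fun _ : Bool =>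
    D ⊗ₘ iidKernel (Z := Z) (Fin n × Bool)).prod (Measure.pi fun _ : Fin K => coin))).skew_product
    (μc := Measure.pi fun _ : Fin K => Measure.pi fun _ : Bool => Measure.pi fun _ : Fin n => coin)
    (μd := coin) (g := fun a u => u i (a.2 i) j)
    ((measurable_selectedBit_super (Z := Z) i j).comp (by fun_prop :
      Measurable fun p : ((Fin K → Bool → ProbabilityMeasure Z × (Fin n × Bool → Z)) ×
        (Fin K → Bool)) × (Fin K → Bool → Fin n → Bool) => (p.1.1, (p.1.2, p.2))))
    (ae_of_all _ fun a =>
      ((measurePreserving_eval (fun _ : Fin n => coin) j).comp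
        ((measurePreserving_eval (fun _ : Bool => Measure.pi fun _ : Fin n => coin) (a.2 i)).comp
        (measurePreserving_eval (fun _ : Fin K => Measure.pi fun _ : Bool =>
          Measure.pi fun _ : Fin n => coin) i))).map_eq)
  exact map_prodMk_coin_of_measurePreserving (h4.comp (h3.comp h1)) hφ

/-! ### Decomposition of the generalization error -/

variable {loss : 𝒲 → Z → ℝ}

lemma measurable_loss {R : Type*} [MeasurableSpace R] (hmeas : Measurable (Function.uncurry loss))
    {f : R → 𝒲} {g : R → Z} (hf : Measurable f) (hg : Measurable g) :
    Measurable fun a => loss (f a) (g a) :=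
  hmeas.comp (hf.prodMk hg)

lemma measurable_clientRisk {R : Type*} [MeasurableSpace R]
    (hmeas : Measurable (Function.uncurry loss)) {f : R → 𝒲} {g : R → ProbabilityMeasure Z}
    (hf : Measurable f) (hg : Measurable g) : Measurable fun a => clientRisk loss (f a) (g a) :=
  measurable_integral_kernel (κ := clientKernel.comap g hg) (g := fun q => loss (f q.1) q.2)
    (measurable_loss hmeas (by fun_prop) measurable_snd)

lemma popRisk_eq_integral_ghost (hmeas : Measurable (Function.uncurry loss))
    (hbdd : ∀ w z, loss w z ∈ Set.Icc (0 : ℝ) 1) (w : 𝒲) :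
    popRisk D loss w = ∫ p, loss w p.2 ∂(D ⊗ₘ clientKernel) := by
  rw [Measure.integral_compProd]
  · rfl
  · exact integrable_of_abs_le_one (measurable_loss hmeas measurable_const measurable_snd)
      fun p => abs_le_one_of_mem_Icc (hbdd _ _)

lemma integral_ghost {E : Type*} [MeasurableSpace E] {e : Super K n Z → E} (he : Measurable e)
    (κ : Kernel (Tree K n Z) E) [IsMarkovKernel κ]
    (h : (superLaw K n D).map (fun s => (selectedTree s, e s)) = treeLaw K n D ⊗ₘ κ)
    {g : (Tree K n Z × 𝒲) × E → ℝ} (hg : Measurable g) (hb : ∀ p, |g p| ≤ 1) :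
    ∫ ω, g ((selectedTree ω.1, ω.2), e ω.1) ∂(jointLaw D A) =
      ∫ p, ∫ x, g (p, x) ∂(κ p.1) ∂(treeLaw K n D ⊗ₘ A) := by
  have hT := measurable_selectedTree K n (Z := Z)
  rw [← integral_map (φ := fun ω : Super K n Z × 𝒲 => ((selectedTree ω.1, ω.2), e ω.1))
    (by fun_prop) hg.aestronglyMeasurable, jointLaw_map_ghost D A he κ h,
    Measure.integral_compProd (integrable_of_abs_le_one hg hb)]
  rfl

lemma integral_clientRisk_selected (hmeas : Measurable (Function.uncurry loss))
    (hbdd : ∀ w z, loss w z ∈ Set.Icc (0 : ℝ) 1) (i : Fin K) (j : Fin n) :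
    ∫ ω, loss ω.2 (ghostPoint i j (ω.1.2.1 i) ω.1).2 ∂(jointLaw D A) =
      ∫ p, clientRisk loss p.2 (p.1 i).1 ∂(treeLaw K n D ⊗ₘ A) :=
  integral_ghost D A (measurable_snd.comp (measurable_ghostPoint_bit i j id)) _
    (map_selectedTree_ghostPoint D i j) (g := fun q => loss q.1.2 q.2)
    (measurable_loss hmeas (by fun_prop) (by fun_prop))
    fun _ => abs_le_one_of_mem_Icc (hbdd _ _)

lemma integral_selected (i : Fin K) (j : Fin n) {g : Tree K n Z × 𝒲 → ℝ} (hg : Measurable g)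
    (hb : ∀ p, |g p| ≤ 1) :
    ∫ ω, g (selectedTree ω.1, ω.2) ∂(jointLaw D A) = ∫ p, g p ∂(treeLaw K n D ⊗ₘ A) := by
  have := integral_ghost D A (measurable_ghostPoint_bit i j not) _
    (map_selectedTree_ghostPoint_not D i j) (g := fun q => g q.1) (by fun_prop) fun _ => hb _
  simpa using this

lemma integral_popRisk_eq_unselected_loss (hmeas : Measurable (Function.uncurry loss))
    (hbdd : ∀ w z, loss w z ∈ Set.Icc (0 : ℝ) 1) (i : Fin K) (j : Fin n) :
    ∫ ω, loss ω.2 (ghostPoint i j (!ω.1.2.1 i) ω.1).2 ∂(jointLaw D A) =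
      ∫ p, popRisk D loss p.2 ∂(treeLaw K n D ⊗ₘ A) := by
  simp_rw [popRisk_eq_integral_ghost D hmeas hbdd]
  exact integral_ghost D A (measurable_ghostPoint_bit i j not) _
    (map_selectedTree_ghostPoint_not D i j) (g := fun q => loss q.1.2 q.2.2)
    (measurable_loss hmeas (by fun_prop) (by fun_prop)) fun _ => abs_le_one_of_mem_Icc (hbdd _ _)

lemma integral_popRisk_eq_unselected_clientRisk (hmeas : Measurable (Function.uncurry loss))
    (hbdd : ∀ w z, loss w z ∈ Set.Icc (0 : ℝ) 1) (i : Fin K) (j : Fin n) :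
    ∫ ω, clientRisk loss ω.2 (ghostPoint i j (!ω.1.2.1 i) ω.1).1 ∂(jointLaw D A) =
      ∫ p, popRisk D loss p.2 ∂(treeLaw K n D ⊗ₘ A) := by
  refine (integral_ghost D A (measurable_ghostPoint_bit i j not) _
    (map_selectedTree_ghostPoint_not D i j) (g := fun q => clientRisk loss q.1.2 q.2.1)
    (measurable_clientRisk hmeas (by fun_prop) (by fun_prop))
    fun _ => abs_le_one_of_mem_Icc (clientRisk_mem_Icc hbdd _ _)).trans ?_
  refine integral_congr_ae (ae_of_all _ fun p => ?_)
  simp only [Kernel.const_apply]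
  rw [Measure.integral_compProd]
  · simp [popRisk_eq_integral_clientRisk]
  · exact integrable_of_abs_le_one (measurable_clientRisk hmeas (by fun_prop) (by fun_prop))
      fun _ => abs_le_one_of_mem_Icc (clientRisk_mem_Icc hbdd _ _)

end Model

/-! ### Gaps as expectations of sign-changing functions -/

section Gaps

variable {Z 𝒲 : Type*} [MeasurableSpace Z] [MeasurableSpace 𝒲] {K n : ℕ}
  (D : Measure (ProbabilityMeasure Z)) [IsProbabilityMeasure D]
  (A : Kernel (Tree K n Z) 𝒲) [IsMarkovKernel A] {loss : 𝒲 → Z → ℝ}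

lemma measurable_hyp : Measurable (hyp : Super K n Z × 𝒲 → 𝒲) := measurable_snd

lemma measurable_bitV (i : Fin K) : Measurable (bitV i : Super K n Z × 𝒲 → Bool) := by
  unfold bitV; fun_prop

lemma measurable_selectedBit (i : Fin K) (j : Fin n) :
    Measurable (selectedBit i j : Super K n Z × 𝒲 → Bool) :=
  (measurable_selectedBit_super i j).comp measurable_fst

lemma measurable_clientPair (i : Fin K) :
    Measurable (clientPair i : Super K n Z × 𝒲 → Bool → ProbabilityMeasure Z) := by
  unfold clientPair; fun_prop

lemma measurable_sampleOf (i : Fin K) :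
    Measurable (sampleOf i : Super K n Z × 𝒲 → Bool → Fin n × Bool → Z) := by
  unfold sampleOf; fun_prop

lemma measurable_bitsU (i : Fin K) :
    Measurable (bitsU i : Super K n Z × 𝒲 → Bool → Fin n → Bool) := by
  unfold bitsU; fun_prop

/-- The `j`-th pair of data points of the client selected by the bit. -/
def pairOf (j : Fin n) (p : (Bool → Fin n × Bool → Z) × Bool) : Bool → Z := fun c => p.1 p.2 (j, c)

lemma measurable_pairOf (j : Fin n) : Measurable (pairOf (Z := Z) j) :=
  measurable_pi_lambda _ fun c => measurable_bool_apply
    (f := fun b (p : (Bool → Fin n × Bool → Z) × Bool) => p.1 b (j, c)) (b := Prod.snd)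
    (fun b => by fun_prop) measurable_snd

lemma measurable_leafPair (i : Fin K) (j : Fin n) :
    Measurable (leafPair i j : Super K n Z × 𝒲 → Bool → Z) :=
  (measurable_pairOf j).comp ((measurable_sampleOf i).prodMk (measurable_bitV i))

/-! ### The gaps at the two levels -/

/-- The expected difference between the population risk and the risk of the `i`-th client. -/
noncomputable def clientGap (loss : 𝒲 → Z → ℝ) (i : Fin K) : ℝ :=
  ∫ p, popRisk D loss p.2 ∂(treeLaw K n D ⊗ₘ A) -
    ∫ p, clientRisk loss p.2 (p.1 i).1 ∂(treeLaw K n D ⊗ₘ A)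

/-- The expected difference between the risk of the `i`-th client and the loss at its `j`-th data
point. -/
noncomputable def dataGap (loss : 𝒲 → Z → ℝ) (i : Fin K) (j : Fin n) : ℝ :=
  ∫ p, clientRisk loss p.2 (p.1 i).1 ∂(treeLaw K n D ⊗ₘ A) -
    ∫ p, loss p.2 ((p.1 i).2 j) ∂(treeLaw K n D ⊗ₘ A)

/-- The risk of client i is added and subtracted in each summand; positivity of K and n makes the
averages of constants equal to the constants. -/
lemma genError_eq (hK : 0 < K) (hn : 0 < n) (hmeas : Measurable (Function.uncurry loss))
    (hbdd : ∀ w z, loss w z ∈ Set.Icc (0 : ℝ) 1) :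
    genError D A loss = (K : ℝ)⁻¹ * ∑ i, clientGap D A loss i +
      ((K : ℝ) * n)⁻¹ * ∑ i, ∑ j, dataGap D A loss i j := by
  have hl : ∀ i j, Integrable (fun p : Tree K n Z × 𝒲 => loss p.2 ((p.1 i).2 j))
      (treeLaw K n D ⊗ₘ A) := fun i j =>
    integrable_of_abs_le_one (measurable_loss hmeas (by fun_prop) (by fun_prop))
      fun _ => abs_le_one_of_mem_Icc (hbdd _ _)
  have hp : Integrable (fun p : Tree K n Z × 𝒲 => popRisk D loss p.2) (treeLaw K n D ⊗ₘ A) := by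
    refine integrable_of_abs_le_one ?_ fun p => abs_le_one_of_mem_Icc
      (integral_mem_Icc fun m => clientRisk_mem_Icc hbdd p.2 m)
    have hm : Measurable fun q : 𝒲 × ProbabilityMeasure Z => clientRisk loss q.1 q.2 :=
      measurable_clientRisk hmeas measurable_fst measurable_snd
    exact (measurable_integral_kernel (κ := Kernel.const 𝒲 D) hm).comp measurable_snd
  have hK' : (K : ℝ) ≠ 0 := by exact_mod_cast hK.ne'
  have hn' : (n : ℝ) ≠ 0 := by exact_mod_cast hn.ne'
  simp only [genError, empRisk, clientGap, dataGap]
  rw [integral_sub hp ((integrable_finsetSum _ fun i _ => integrable_finsetSum _ fun j _ =>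
    hl i j).const_mul _), integral_const_mul, integral_finsetSum _ fun i _ =>
    integrable_finsetSum _ fun j _ => hl i j]
  simp_rw [integral_finsetSum _ fun j _ => hl _ j, Finset.sum_sub_distrib]
  simp only [Finset.sum_const, Finset.card_univ, Fintype.card_fin, nsmul_eq_mul, ← Finset.mul_sum]
  field_simp
  ring

/-- The nonparticipating client is a fresh draw from D given the tree and W, so its risk averages to
the population risk. For both values of V_i the integrand is the risk of the unselected client minus
that of the selected one. -/
lemma clientGap_eq_integral_clientPair (hn : 0 < n) (hmeas : Measurable (Function.uncurry loss))
    (hbdd : ∀ w z, loss w z ∈ Set.Icc (0 : ℝ) 1) (i : Fin K) :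
    clientGap D A loss i = ∫ ω, (clientRisk loss (hyp ω) (clientPair i ω false) -
      clientRisk loss (hyp ω) (clientPair i ω true)) * bitSign (bitV i ω) ∂(jointLaw D A) := by
  have hg : Measurable fun p : Tree K n Z × 𝒲 => clientRisk loss p.2 (p.1 i).1 :=
    measurable_clientRisk hmeas (by fun_prop) (by fun_prop)
  have hb : ∀ p : Tree K n Z × 𝒲, |clientRisk loss p.2 (p.1 i).1| ≤ 1 := fun p =>
    abs_le_one_of_mem_Icc (clientRisk_mem_Icc hbdd _ _)
  have hT := measurable_selectedTree K n (Z := Z)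
  have hG := measurable_ghostPoint_bit (Z := Z) i ⟨0, hn⟩ not
  rw [clientGap, ← integral_popRisk_eq_unselected_clientRisk D A hmeas hbdd i ⟨0, hn⟩,
    ← integral_selected D A i ⟨0, hn⟩ hg hb, ← integral_sub]
  · refine integral_congr_ae (ae_of_all _ fun ω => ?_)
    simp only [clientPair, hyp, bitV, ghostPoint, selectedTree]
    cases ω.1.2.1 i <;> simp [bitSign]
  · exact integrable_of_abs_le_one (measurable_clientRisk hmeas (by fun_prop)
      (hG.comp measurable_fst).fst)
      fun _ => abs_le_one_of_mem_Icc (clientRisk_mem_Icc hbdd _ _)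
  · exact integrable_of_abs_le_one (hg.comp (by fun_prop)) fun _ => hb _

/-- Both client risks are replaced by the loss at a point that the bits U do not select. Such a
point is unused even for the participating client, hence unbiased, and the integrand no longer
mentions the clients: it is a function of Z^i, U^i, V_i and W. -/
lemma clientGap_eq_integral_sampleOf (hmeas : Measurable (Function.uncurry loss))
    (hbdd : ∀ w z, loss w z ∈ Set.Icc (0 : ℝ) 1) (i : Fin K) (j : Fin n) :
    clientGap D A loss i =
      ∫ ω, (loss (hyp ω) (sampleOf i ω false (j, !bitsU i ω false j)) -
        loss (hyp ω) (sampleOf i ω true (j, !bitsU i ω true j))) * bitSign (bitV i ω)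
        ∂(jointLaw D A) := by
  have hG := measurable_ghostPoint_bit (Z := Z) i j not
  have hG' := measurable_ghostPoint_bit (Z := Z) i j id
  simp only [id] at hG'
  rw [clientGap, ← integral_popRisk_eq_unselected_loss D A hmeas hbdd i j,
    ← integral_clientRisk_selected D A hmeas hbdd i j, ← integral_sub]
  · refine integral_congr_ae (ae_of_all _ fun ω => ?_)
    simp only [sampleOf, bitsU, hyp, bitV, ghostPoint]
    cases ω.1.2.1 i <;> simp [bitSign]
  · exact integrable_of_abs_le_one (measurable_loss hmeas (by fun_prop)
      (hG.comp measurable_fst).snd)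
      fun _ => abs_le_one_of_mem_Icc (hbdd _ _)
  · exact integrable_of_abs_le_one (measurable_loss hmeas (by fun_prop)
      (hG'.comp measurable_fst).snd)
      fun _ => abs_le_one_of_mem_Icc (hbdd _ _)

/-- Within the participating client the unselected point of the pair is fresh, so its expected loss
is that of the client risk; the selected point is the training point. -/
lemma dataGap_eq_integral_leafPair (hmeas : Measurable (Function.uncurry loss))
    (hbdd : ∀ w z, loss w z ∈ Set.Icc (0 : ℝ) 1) (i : Fin K) (j : Fin n) :
    dataGap D A loss i j =
      ∫ ω, (loss (hyp ω) (leafPair i j ω false) - loss (hyp ω) (leafPair i j ω true)) *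
        bitSign (selectedBit i j ω) ∂(jointLaw D A) := by
  have hg : Measurable fun p : Tree K n Z × 𝒲 => loss p.2 ((p.1 i).2 j) :=
    measurable_loss hmeas (by fun_prop) (by fun_prop)
  have hT := measurable_selectedTree K n (Z := Z)
  have hG' := measurable_ghostPoint_bit (Z := Z) i j id
  simp only [id] at hG'
  rw [dataGap, ← integral_clientRisk_selected D A hmeas hbdd i j,
    ← integral_selected D A i j hg fun p => abs_le_one_of_mem_Icc (hbdd _ _), ← integral_sub]
  · refine integral_congr_ae (ae_of_all _ fun ω => ?_)
    simp only [leafPair, sampleOf, selectedBit, bitsU, hyp, bitV, ghostPoint, selectedTree]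
    cases ω.1.2.2 i (ω.1.2.1 i) j <;> simp [bitSign]
  · exact integrable_of_abs_le_one (measurable_loss hmeas (by fun_prop)
      (hG'.comp measurable_fst).snd)
      fun _ => abs_le_one_of_mem_Icc (hbdd _ _)
  · exact integrable_of_abs_le_one (hg.comp (by fun_prop))
      fun _ => abs_le_one_of_mem_Icc (hbdd _ _)

/-! ### Independence of the selection bits and of the conditioning variables -/

lemma jointLaw_map_clientPair_bitV (i : Fin K) :
    (jointLaw D A).map (fun ω => (clientPair i ω, bitV i ω)) =
      ((jointLaw D A).map (clientPair i)).prod coin :=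
  jointLaw_map_bitV D A i (φ := fun p b => (p.1 i b).1) (by fun_prop)

lemma jointLaw_map_sampleOf_bitsU_bitV (i : Fin K) :
    (jointLaw D A).map (fun ω => ((sampleOf i ω, bitsU i ω), bitV i ω)) =
      ((jointLaw D A).map fun ω => (sampleOf i ω, bitsU i ω)).prod coin :=
  jointLaw_map_bitV D A i (φ := fun p => (fun b => (p.1 i b).2, p.2 i)) (by fun_prop)

lemma jointLaw_map_sampleOf_bitV_selectedBit (i : Fin K) (j : Fin n) :
    (jointLaw D A).map (fun ω => ((sampleOf i ω, bitV i ω), selectedBit i j ω)) =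
      ((jointLaw D A).map fun ω => (sampleOf i ω, bitV i ω)).prod coin :=
  jointLaw_map_selectedBit D A i j (φ := fun p => (fun b => (p.1 i b).2, p.2 i)) (by fun_prop)

lemma jointLaw_map_leafPair_selectedBit (i : Fin K) (j : Fin n) :
    (jointLaw D A).map (fun ω => (leafPair i j ω, selectedBit i j ω)) =
      ((jointLaw D A).map (leafPair i j)).prod coin :=
  jointLaw_map_selectedBit D A i j (φ := fun p => pairOf j (fun b => (p.1 i b).2, p.2 i))
    ((measurable_pairOf j).comp (by fun_prop))

/-! ### Bounds on the gaps -/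

lemma ofReal_abs_genError_le (hK : 0 < K) (hn : 0 < n) (hmeas : Measurable (Function.uncurry loss))
    (hbdd : ∀ w z, loss w z ∈ Set.Icc (0 : ℝ) 1) {a : Fin K → ℝ≥0∞} {b : Fin K → Fin n → ℝ≥0∞}
    (ha : ∀ i, ENNReal.ofReal |clientGap D A loss i| ≤ a i)
    (hb : ∀ i j, ENNReal.ofReal |dataGap D A loss i j| ≤ b i j) :
    ENNReal.ofReal |genError D A loss| ≤
      (K : ℝ≥0∞)⁻¹ * ∑ i, a i + ((K : ℝ≥0∞) * n)⁻¹ * ∑ i, ∑ j, b i j := by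
  have hK' : (0 : ℝ) < K := by exact_mod_cast hK
  have hn' : (0 : ℝ) < n := by exact_mod_cast hn
  have h : |genError D A loss| ≤ (K : ℝ)⁻¹ * ∑ i, |clientGap D A loss i| +
      ((K : ℝ) * n)⁻¹ * ∑ i, ∑ j, |dataGap D A loss i j| := by
    rw [genError_eq D A hK hn hmeas hbdd]
    refine (abs_add_le _ _).trans ?_
    rw [abs_mul, abs_mul, abs_of_pos (inv_pos.2 hK'), abs_of_pos (inv_pos.2 (mul_pos hK' hn'))]
    gcongr
    · exact Finset.abs_sum_le_sum_abs _ _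
    · exact (Finset.abs_sum_le_sum_abs _ _).trans
        (Finset.sum_le_sum fun i _ => Finset.abs_sum_le_sum_abs _ _)
  refine (ENNReal.ofReal_le_ofReal h).trans ?_
  rw [ENNReal.ofReal_add (by positivity) (by positivity), ENNReal.ofReal_mul (by positivity),
    ENNReal.ofReal_mul (by positivity), ENNReal.ofReal_inv_of_pos hK',
    ENNReal.ofReal_inv_of_pos (by positivity), ENNReal.ofReal_mul (by positivity),
    ENNReal.ofReal_natCast, ENNReal.ofReal_natCast,
    ENNReal.ofReal_sum_of_nonneg fun _ _ => abs_nonneg _,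
    ENNReal.ofReal_sum_of_nonneg fun _ _ => Finset.sum_nonneg fun _ _ => abs_nonneg _]
  gcongr with i _ i _
  · exact ha i
  · rw [ENNReal.ofReal_sum_of_nonneg fun _ _ => abs_nonneg _]
    exact Finset.sum_le_sum fun j _ => hb i j

variable [StandardBorelSpace 𝒲] [Nonempty 𝒲]

lemma ofReal_abs_clientGap_le_expectedWasserstein (hn : 0 < n)
    (hmeas : Measurable (Function.uncurry loss)) (hbdd : ∀ w z, loss w z ∈ Set.Icc (0 : ℝ) 1)
    (i : Fin K) : ENNReal.ofReal |clientGap D A loss i| ≤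
      2 * expectedWasserstein (jointLaw D A) hyp (bitV i) (clientPair i) := by
  rw [clientGap_eq_integral_clientPair D A hn hmeas hbdd i]
  exact ofReal_abs_integral_mul_bitSign_le_expectedWasserstein (measurable_clientPair i)
    (measurable_bitV i) measurable_hyp (jointLaw_map_clientPair_bitV D A i)
    (f := fun p => clientRisk loss p.2 (p.1 false) - clientRisk loss p.2 (p.1 true))
    ((measurable_clientRisk hmeas (by fun_prop) (by fun_prop)).sub
      (measurable_clientRisk hmeas (by fun_prop) (by fun_prop)))
    fun p => abs_sub_le_one (clientRisk_mem_Icc hbdd _ _) (clientRisk_mem_Icc hbdd _ _)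

lemma ofReal_abs_dataGap_le_expectedWasserstein
    (hmeas : Measurable (Function.uncurry loss)) (hbdd : ∀ w z, loss w z ∈ Set.Icc (0 : ℝ) 1)
    (i : Fin K) (j : Fin n) : ENNReal.ofReal |dataGap D A loss i j| ≤
      2 * expectedWasserstein (jointLaw D A) hyp (selectedBit i j) (leafPair i j) := by
  rw [dataGap_eq_integral_leafPair D A hmeas hbdd i]
  exact ofReal_abs_integral_mul_bitSign_le_expectedWasserstein (measurable_leafPair i j)
    (measurable_selectedBit i j) measurable_hyp (jointLaw_map_leafPair_selectedBit D A i j)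
    (f := fun p => loss p.2 (p.1 false) - loss p.2 (p.1 true))
    ((measurable_loss hmeas (by fun_prop) (by fun_prop)).sub
      (measurable_loss hmeas (by fun_prop) (by fun_prop)))
    fun p => abs_sub_le_one (hbdd _ _) (hbdd _ _)

lemma ofReal_abs_clientGap_le_expectedSqrtCMI (hn : 0 < n)
    (hmeas : Measurable (Function.uncurry loss)) (hbdd : ∀ w z, loss w z ∈ Set.Icc (0 : ℝ) 1)
    (i : Fin K) : ENNReal.ofReal |clientGap D A loss i| ≤
      expectedSqrtCMI (jointLaw D A) hyp (bitV i) (fun ω => (sampleOf i ω, bitsU i ω)) := by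
  rw [clientGap_eq_integral_sampleOf D A hmeas hbdd i ⟨0, hn⟩]
  have hz : ∀ b, Measurable fun p : ((Bool → Fin n × Bool → Z) × (Bool → Fin n → Bool)) × 𝒲 =>
      p.1.1 b (⟨0, hn⟩, !p.1.2 b ⟨0, hn⟩) := fun b =>
    measurable_bool_apply (f := fun c (p : ((Bool → Fin n × Bool → Z) ×
      (Bool → Fin n → Bool)) × 𝒲) => p.1.1 b (⟨0, hn⟩, c)) (fun c => by fun_prop)
      ((measurable_of_finite not).comp (by fun_prop : Measurable fun p :
        ((Bool → Fin n × Bool → Z) × (Bool → Fin n → Bool)) × 𝒲 => p.1.2 b ⟨0, hn⟩))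
  exact ofReal_abs_integral_mul_bitSign_le_expectedSqrtCMI
    ((measurable_sampleOf i).prodMk (measurable_bitsU i))
    (measurable_bitV i) measurable_hyp (jointLaw_map_sampleOf_bitsU_bitV D A i)
    (f := fun p => loss p.2 (p.1.1 false (⟨0, hn⟩, !p.1.2 false ⟨0, hn⟩)) -
      loss p.2 (p.1.1 true (⟨0, hn⟩, !p.1.2 true ⟨0, hn⟩)))
    ((measurable_loss hmeas (by fun_prop) (hz false)).sub
      (measurable_loss hmeas (by fun_prop) (hz true)))
    fun p => abs_sub_le_one (hbdd _ _) (hbdd _ _)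

lemma ofReal_abs_dataGap_le_expectedSqrtCMI_sampleOf
    (hmeas : Measurable (Function.uncurry loss)) (hbdd : ∀ w z, loss w z ∈ Set.Icc (0 : ℝ) 1)
    (i : Fin K) (j : Fin n) : ENNReal.ofReal |dataGap D A loss i j| ≤
      expectedSqrtCMI (jointLaw D A) hyp (selectedBit i j)
        (fun ω => (sampleOf i ω, bitV i ω)) := by
  rw [dataGap_eq_integral_leafPair D A hmeas hbdd i]
  have hz : ∀ c, Measurable fun p : ((Bool → Fin n × Bool → Z) × Bool) × 𝒲 => pairOf j p.1 c :=
    fun c => (measurable_pi_apply c).comp ((measurable_pairOf j).comp measurable_fst)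
  exact ofReal_abs_integral_mul_bitSign_le_expectedSqrtCMI
    ((measurable_sampleOf i).prodMk (measurable_bitV i))
    (measurable_selectedBit i j) measurable_hyp (jointLaw_map_sampleOf_bitV_selectedBit D A i j)
    (f := fun p => loss p.2 (pairOf j p.1 false) - loss p.2 (pairOf j p.1 true))
    ((measurable_loss hmeas (by fun_prop) (hz false)).sub
      (measurable_loss hmeas (by fun_prop) (hz true)))
    fun p => abs_sub_le_one (hbdd _ _) (hbdd _ _)

lemma ofReal_abs_dataGap_le_expectedSqrtCMI_leafPair
    (hmeas : Measurable (Function.uncurry loss)) (hbdd : ∀ w z, loss w z ∈ Set.Icc (0 : ℝ) 1)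
    (i : Fin K) (j : Fin n) : ENNReal.ofReal |dataGap D A loss i j| ≤
      expectedSqrtCMI (jointLaw D A) hyp (selectedBit i j) (leafPair i j) := by
  rw [dataGap_eq_integral_leafPair D A hmeas hbdd i]
  exact ofReal_abs_integral_mul_bitSign_le_expectedSqrtCMI (measurable_leafPair i j)
    (measurable_selectedBit i j) measurable_hyp (jointLaw_map_leafPair_selectedBit D A i j)
    (f := fun p => loss p.2 (p.1 false) - loss p.2 (p.1 true))
    ((measurable_loss hmeas (by fun_prop) (by fun_prop)).sub
      (measurable_loss hmeas (by fun_prop) (by fun_prop)))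
    fun p => abs_sub_le_one (hbdd _ _) (hbdd _ _)

lemma wassersteinBound_eq : wassersteinBound D A =
    (K : ℝ≥0∞)⁻¹ * ∑ i : Fin K,
        2 * expectedWasserstein (jointLaw D A) hyp (bitV i) (clientPair i)
    + ((K : ℝ≥0∞) * n)⁻¹ * ∑ i : Fin K, ∑ j : Fin n,
        2 * expectedWasserstein (jointLaw D A) hyp (selectedBit i j) (leafPair i j) := by
  simp only [wassersteinBound, ← Finset.mul_sum]
  ring

end Gaps

/-! ### Resampling of one coordinate -/

lemma measurePreserving_prodProdProdComm {A B C E : Type*} [MeasurableSpace A] [MeasurableSpace B]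
    [MeasurableSpace C] [MeasurableSpace E] (μ : Measure A) (ν : Measure B) (μ' : Measure C)
    (ν' : Measure E) [SFinite μ] [SFinite ν] [SFinite μ'] [SFinite ν'] :
    MeasurePreserving (fun p : (A × B) × (C × E) => ((p.1.1, p.2.1), (p.1.2, p.2.2)))
      ((μ.prod ν).prod (μ'.prod ν')) ((μ.prod μ').prod (ν.prod ν')) := by
  have h1 := measurePreserving_prodAssoc μ ν (μ'.prod ν')
  have h2 := (MeasurePreserving.id μ).prod (measurePreserving_prodAssoc ν μ' ν').symm
  have h3 := (MeasurePreserving.id μ).prod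
    ((Measure.measurePreserving_swap (μ := ν) (ν := μ')).prod (MeasurePreserving.id ν'))
  have h4 := (MeasurePreserving.id μ).prod (measurePreserving_prodAssoc μ' ν ν')
  have h5 := (measurePreserving_prodAssoc μ μ' (ν.prod ν')).symm
  exact h5.comp (h4.comp (h3.comp (h2.comp h1)))

lemma measurePreserving_prod_binary {A B : Type*} [MeasurableSpace A] [MeasurableSpace B]
    {μ : Measure A} {ν : Measure B} [SFinite μ] [SFinite ν] {F : A × A → A} {G : B × B → B}
    (hF : MeasurePreserving F (μ.prod μ) μ) (hG : MeasurePreserving G (ν.prod ν) ν) :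
    MeasurePreserving (fun p : (A × B) × (A × B) => (F (p.1.1, p.2.1), G (p.1.2, p.2.2)))
      ((μ.prod ν).prod (μ.prod ν)) (μ.prod ν) :=
  (hF.prod hG).comp (measurePreserving_prodProdProdComm μ ν μ ν)

lemma measurePreserving_update_eval {ι : Type*} [Fintype ι] [DecidableEq ι] {X : ι → Type*}
    [∀ i, MeasurableSpace (X i)] (μ : ∀ i, Measure (X i)) [∀ i, IsProbabilityMeasure (μ i)]
    (i : ι) : MeasurePreserving (fun p : (∀ i, X i) × (∀ i, X i) => Function.update p.1 i (p.2 i))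
      ((Measure.pi μ).prod (Measure.pi μ)) (Measure.pi μ) :=
  (measurePreserving_update μ i).comp
    ((MeasurePreserving.id (Measure.pi μ)).prod (measurePreserving_eval μ i))

section Model

variable {Z 𝒲 : Type*} [MeasurableSpace Z] [MeasurableSpace 𝒲] {K n : ℕ}
  (D : Measure (ProbabilityMeasure Z)) [IsProbabilityMeasure D]

/-- Replace everything that concerns the `i`-th superclient. -/
def replaceBlock (i : Fin K) (p : Super K n Z × Super K n Z) : Super K n Z :=
  (Function.update p.1.1 i (p.2.1 i),
    (Function.update p.1.2.1 i (p.2.2.1 i), Function.update p.1.2.2 i (p.2.2.2 i)))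

/-- Blocks are independent, so a block may be taken from an independent copy. This separates block i
from the rest of the training tree. -/
lemma measurePreserving_replaceBlock (i : Fin K) :
    MeasurePreserving (replaceBlock (Z := Z) (n := n) i)
      ((superLaw K n D).prod (superLaw K n D)) (superLaw K n D) :=
  measurePreserving_prod_binary
    (measurePreserving_update_eval (fun _ : Fin K => Measure.pi fun _ : Bool =>
      D ⊗ₘ iidKernel (Z := Z) (Fin n × Bool)) i)
    (measurePreserving_prod_binary (measurePreserving_update_eval (fun _ : Fin K => coin) i)
      (measurePreserving_update_eval (fun _ : Fin K => Measure.pi fun _ : Bool =>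
        Measure.pi fun _ : Fin n => coin) i))

lemma selectedTree_replaceBlock (i : Fin K) (p : Super K n Z × Super K n Z) :
    selectedTree (replaceBlock i p) = Function.update (selectedTree p.1) i (selectedTree p.2 i) := by
  ext1 k
  by_cases hk : k = i
  · subst hk; simp [selectedTree, replaceBlock]
  · simp [selectedTree, replaceBlock, hk]

/-! ### Algorithms that only use the data -/

/-- The data selected by the bits in one block. -/
def selectedData (q : ((Bool → Fin n × Bool → Z) × (Bool → Fin n → Bool)) × Bool) : Fin n → Z :=
  fun j => q.1.1 q.2 (j, q.1.2 q.2 j)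

lemma measurable_selectedData : Measurable (selectedData (Z := Z) (n := n)) := by
  refine measurable_pi_lambda _ fun j => ?_
  refine measurable_bool_apply (b := Prod.snd)
    (f := fun b (q : ((Bool → Fin n × Bool → Z) × (Bool → Fin n → Bool)) × Bool) =>
      q.1.1 b (j, q.1.2 b j)) (fun b => ?_) measurable_snd
  exact measurable_bool_apply (b := fun q : ((Bool → Fin n × Bool → Z) ×
      (Bool → Fin n → Bool)) × Bool => q.1.2 b j)
    (f := fun c (q : ((Bool → Fin n × Bool → Z) × (Bool → Fin n → Bool)) × Bool) =>
      q.1.1 b (j, c)) (fun c => by fun_prop) (by fun_prop)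

/-- Forget the clients of a block. -/
def forgetClients (x : (Bool → ProbabilityMeasure Z × (Fin n × Bool → Z)) ×
    (Bool → Fin n → Bool)) : (Bool → Fin n × Bool → Z) × (Bool → Fin n → Bool) :=
  (fun b => (x.1 b).2, x.2)

lemma measurable_forgetClients : Measurable (forgetClients (Z := Z) (n := n)) := by
  unfold forgetClients; fun_prop

variable (A : Kernel (Tree K n Z) 𝒲) [IsMarkovKernel A]

/-- If the algorithm only uses the data, then the hypothesis depends on a block of the supersample
only through its data and its bits. -/
lemma exists_kernel_jointLaw_map_block (hn : 0 < n) (hA : UsesOnlyData A) (i : Fin K) :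
    ∃ Q : Kernel (((Bool → Fin n × Bool → Z) × (Bool → Fin n → Bool)) × Bool) 𝒲,
      IsMarkovKernel Q ∧
      (jointLaw D A).map (fun ω => (((ω.1.1 i, ω.1.2.2 i), bitV i ω), hyp ω)) =
        (((jointLaw D A).map fun ω => (ω.1.1 i, ω.1.2.2 i)).prod coin) ⊗ₘ
          Q.comap (Prod.map forgetClients id)
            (measurable_forgetClients.prodMap measurable_id) := by
  obtain ⟨c⟩ : Nonempty (ProbabilityMeasure Z) := nonempty_of_isProbabilityMeasure D
  have hT := measurable_selectedTree K n (Z := Z)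
  let h : (((Bool → Fin n × Bool → Z) × (Bool → Fin n → Bool)) × Bool) × Tree K n Z →
    Tree K n Z := fun p => Function.update p.2 i (c, selectedData p.1)
  have hh : Measurable h := measurable_update'.comp (measurable_snd.prodMk
    (measurable_const.prodMk (measurable_selectedData.comp measurable_fst)))
  -- Given the data and bits of block i, draw a fresh tree, put the selected data into its i-th
  -- branch and run the algorithm. The second marginal, the law of the output, is the required
  -- kernel.
  let κ := (Kernel.const (((Bool → Fin n × Bool → Z) × (Bool → Fin n → Bool)) × Bool)
    (treeLaw K n D)) ⊗ₖ A.comap h hh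
  refine ⟨κ.snd, inferInstance, ?_⟩
  have hQ : ∀ q (g : 𝒲 → ℝ≥0∞), Measurable g →
      ∫⁻ w, g w ∂(κ.snd q) = ∫⁻ t, ∫⁻ w, g w ∂(A (h (q, t))) ∂(treeLaw K n D) := by
    intro q g hg
    rw [Kernel.snd_apply, lintegral_map hg measurable_snd]
    exact Kernel.lintegral_compProd _ _ _ (hg.comp measurable_snd)
  let blk : Super K n Z → ((Bool → ProbabilityMeasure Z × (Fin n × Bool → Z)) ×
    (Bool → Fin n → Bool)) × Bool := fun s => ((s.1 i, s.2.2 i), s.2.1 i)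
  have hblk : Measurable blk := by fun_prop
  refine Measure.ext_of_lintegral _ fun g hg => ?_
  have hmapX : ((jointLaw D A).map fun ω => (ω.1.1 i, ω.1.2.2 i)).prod coin =
      (superLaw K n D).map blk :=
    (jointLaw_map_bitV D A i (φ := fun p => (p.1 i, p.2 i)) (by fun_prop)).symm.trans
      (jointLaw_map_comp_fst D A hblk)
  rw [lintegral_map hg (by unfold bitV hyp; fun_prop), hmapX, Measure.lintegral_compProd hg,
    lintegral_map (Measurable.lintegral_kernel_prod_right' hg) hblk]
  have e1 : ∫⁻ ω, g (((ω.1.1 i, ω.1.2.2 i), bitV i ω), hyp ω) ∂(jointLaw D A) =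
      ∫⁻ s, ∫⁻ w, g (blk s, w) ∂(A (selectedTree s)) ∂(superLaw K n D) := by
    rw [jointLaw, Measure.lintegral_compProd]
    · rfl
    · unfold bitV hyp; fun_prop
  have hF : Measurable fun s : Super K n Z => ∫⁻ w, g (blk s, w) ∂(A (selectedTree s)) :=
    Measurable.lintegral_kernel_prod_right' (κ := A.comap selectedTree hT)
      (f := fun p => g (blk p.1, p.2)) (by fun_prop)
  have hR := measurePreserving_replaceBlock (n := n) D i
  rw [e1, ← hR.lintegral_comp hF]
  -- The supersample is now s with block i taken from s'. Integrating s inside and s' outside leaves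
  -- block i fixed while the other branches are averaged.
  refine (lintegral_prod_symm _ (hF.comp hR.measurable).aemeasurable).trans ?_
  refine lintegral_congr fun s' => ?_
  rw [Kernel.comap_apply, hQ _ _ (by fun_prop), ← map_selectedTree D hn i]
  have hgA : Measurable fun t => ∫⁻ w, g (blk s', w)
      ∂(A (h (Prod.map forgetClients id (blk s'), t))) :=
    (Measurable.lintegral_kernel (κ := A) (by fun_prop :
      Measurable fun w => g (blk s', w))).comp (hh.comp (by fun_prop))
  rw [lintegral_map hgA hT]
  refine lintegral_congr fun s => ?_
  have hb : blk (replaceBlock i (s, s')) = blk s' := by simp [blk, replaceBlock]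
  rw [Function.comp_apply, hb, selectedTree_replaceBlock]
  congr 1
  refine hA _ _ fun k => ?_
  by_cases hk : k = i
  · subst hk
    simp [h, selectedTree, forgetClients, blk]
    rfl
  · simp [h, hk]

variable [StandardBorelSpace 𝒲] [Nonempty 𝒲]

/-- The optimal test function depends on the clients, which the conditioning variable forgets; the
factorization of the law of W through `forgetClients` makes Pinsker's inequality applicable
nevertheless. -/
lemma two_mul_expectedWasserstein_clientPair_le (hn : 0 < n) (hA : UsesOnlyData A) (i : Fin K) :
    2 * expectedWasserstein (jointLaw D A) hyp (bitV i) (clientPair i) ≤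
      expectedSqrtCMI (jointLaw D A) hyp (bitV i) (fun ω => (sampleOf i ω, bitsU i ω)) := by
  obtain ⟨f, hf, hb, hle⟩ := exists_two_mul_expectedWasserstein_le (measurable_clientPair i)
    (measurable_bitV i) measurable_hyp (jointLaw_map_clientPair_bitV D A i)
  obtain ⟨Q, hQ, h⟩ := exists_kernel_jointLaw_map_block D A hn hA i
  refine hle.trans ?_
  exact ofReal_integral_mul_bitSign_le_expectedSqrtCMI (by fun_prop) (measurable_bitV i)
    measurable_hyp measurable_forgetClients h
    (f := fun p => f (fun b => (p.1.1 b).1, p.2)) (by fun_prop) fun p => hb _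

lemma two_mul_expectedWasserstein_leafPair_le (i : Fin K) (j : Fin n) :
    2 * expectedWasserstein (jointLaw D A) hyp (selectedBit i j) (leafPair i j) ≤
      expectedSqrtCMI (jointLaw D A) hyp (selectedBit i j) (leafPair i j) := by
  obtain ⟨f, hf, hb, hle⟩ := exists_two_mul_expectedWasserstein_le (measurable_leafPair i j)
    (measurable_selectedBit i j) measurable_hyp (jointLaw_map_leafPair_selectedBit D A i j)
  exact hle.trans (ofReal_integral_mul_bitSign_le_expectedSqrtCMI_self (measurable_leafPair i j)
    (measurable_selectedBit i j) measurable_hyp (jointLaw_map_leafPair_selectedBit D A i j) hf hb)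

/-- The leaf pair is a function of (Z^i, V_i), so its optimal test function is admissible for the
finer conditioning, of which the selected bit is still independent. -/
lemma two_mul_expectedWasserstein_leafPair_le_sampleOf (i : Fin K) (j : Fin n) :
    2 * expectedWasserstein (jointLaw D A) hyp (selectedBit i j) (leafPair i j) ≤
      expectedSqrtCMI (jointLaw D A) hyp (selectedBit i j)
        (fun ω => (sampleOf i ω, bitV i ω)) := by
  obtain ⟨f, hf, hb, hle⟩ := exists_two_mul_expectedWasserstein_le (measurable_leafPair i j)
    (measurable_selectedBit i j) measurable_hyp (jointLaw_map_leafPair_selectedBit D A i j)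
  exact hle.trans (ofReal_integral_mul_bitSign_le_expectedSqrtCMI_self
    ((measurable_sampleOf i).prodMk (measurable_bitV i)) (measurable_selectedBit i j)
    measurable_hyp (jointLaw_map_sampleOf_bitV_selectedBit D A i j)
    (f := fun p => f (pairOf j p.1, p.2))
    (hf.comp (((measurable_pairOf j).comp measurable_fst).prodMk measurable_snd)) fun p => hb _)

end Model

end TwoLevelFL

theorem mainTheorem5 {Z 𝒲 : Type*} [MeasurableSpace Z] [MeasurableSpace 𝒲]
    [StandardBorelSpace 𝒲] [Nonempty 𝒲] {K n : ℕ} (hK : 0 < K) (hn : 0 < n)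
    (D : Measure (ProbabilityMeasure Z)) [IsProbabilityMeasure D]
    (A : Kernel (TwoLevelFL.Tree K n Z) 𝒲) [IsMarkovKernel A]
    (loss : 𝒲 → Z → ℝ) (hmeas : Measurable (Function.uncurry loss))
    (hbdd : ∀ w z, loss w z ∈ Set.Icc (0 : ℝ) 1) :
    -- the Wasserstein bound, for the discrete metric
    ENNReal.ofReal |TwoLevelFL.genError D A loss| ≤ TwoLevelFL.wassersteinBound D A ∧
    -- the two-level CMI bound
    ENNReal.ofReal |TwoLevelFL.genError D A loss|
      ≤ TwoLevelFL.participationCMI D A + TwoLevelFL.outOfSampleCMI D A ∧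
    ENNReal.ofReal |TwoLevelFL.genError D A loss|
      ≤ TwoLevelFL.participationCMI D A + TwoLevelFL.outOfSampleLeafCMI D A ∧
    -- for algorithms that see only the data, the Wasserstein bound implies the CMI bound
    (TwoLevelFL.UsesOnlyData A →
      TwoLevelFL.wassersteinBound D A
        ≤ TwoLevelFL.participationCMI D A + TwoLevelFL.outOfSampleCMI D A ∧
      TwoLevelFL.wassersteinBound D A
        ≤ TwoLevelFL.participationCMI D A + TwoLevelFL.outOfSampleLeafCMI D A) := by
  refine ⟨?_, ?_, ?_, fun hA => ⟨?_, ?_⟩⟩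
  · rw [TwoLevelFL.wassersteinBound_eq]
    exact TwoLevelFL.ofReal_abs_genError_le D A hK hn hmeas hbdd
      (TwoLevelFL.ofReal_abs_clientGap_le_expectedWasserstein D A hn hmeas hbdd)
      (TwoLevelFL.ofReal_abs_dataGap_le_expectedWasserstein D A hmeas hbdd)
  · exact TwoLevelFL.ofReal_abs_genError_le D A hK hn hmeas hbdd
      (TwoLevelFL.ofReal_abs_clientGap_le_expectedSqrtCMI D A hn hmeas hbdd)
      (TwoLevelFL.ofReal_abs_dataGap_le_expectedSqrtCMI_sampleOf D A hmeas hbdd)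
  · exact TwoLevelFL.ofReal_abs_genError_le D A hK hn hmeas hbdd
      (TwoLevelFL.ofReal_abs_clientGap_le_expectedSqrtCMI D A hn hmeas hbdd)
      (TwoLevelFL.ofReal_abs_dataGap_le_expectedSqrtCMI_leafPair D A hmeas hbdd)
  · rw [TwoLevelFL.wassersteinBound_eq, TwoLevelFL.participationCMI, TwoLevelFL.outOfSampleCMI]
    gcongr with i _ i _ j _
    · exact TwoLevelFL.two_mul_expectedWasserstein_clientPair_le D A hn hA i
    · exact TwoLevelFL.two_mul_expectedWasserstein_leafPair_le_sampleOf D A i j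
  · rw [TwoLevelFL.wassersteinBound_eq, TwoLevelFL.participationCMI,
      TwoLevelFL.outOfSampleLeafCMI]
    gcongr with i _ i _ j _
    · exact TwoLevelFL.two_mul_expectedWasserstein_clientPair_le D A hn hA i
    · exact TwoLevelFL.two_mul_expectedWasserstein_leafPair_le D A i j
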